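/- Let $\mathcal A$ be an effective Boolean algebra over a domain $D$: a set $\Psi$ of predicates with connectives $\bot,\top,\sqcup,\sqcap,\sim$ and a denotation $[\![\cdot]\!]:\Psi\to 2^D$ that turns them into $\emptyset$, $D$, union, intersection and complement. $\mathrm{LTL}[\mathcal A]$ is generated by the predicates $\alpha\in\Psi$ and $\lnot,\lor,\land,\mathsf X,\mathsf U,\mathsf R$, with the usual semantics over words $w\in D^{\omega}$ (where $w\models\alpha$ iff $w_0\in[\![\alpha]\!]$), and $L(\varphi)=\{w\mid w\models\varphi\}$; $\mathrm{LTL}^+[\mathcal A]$ is the set of formulas without $\lnot$. For a finite set $Q$, let $\mathcal B^+(Q)$ be the positive Boolean combinations over $Q$ (with $\top,\bot$ as unit and zero), and $\mathrm{DNF}(\theta)\subseteq 2^Q$ the disjunctive normal form of $\theta$ as a set of sets. A transition term is a nested if-then-else expression with conditions in $\Psi$; $t(a)$ denotes its leaf for $a\in D$, and operations on leaves are lifted to terms branchwise. An alternating Büchi automaton modulo $\mathcal A$ is $M=(\mathcal A,Q,\iota,\varrho,F)$ with $Q$ finite, $\iota\in\mathcal B^+(Q)$, $F\subseteq Q$ and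 $\varrho$ mapping states to transition terms with leaves in $\mathcal B^+(Q)$. A run for $w$ from $q$ is a $Q$-labelled tree with root label $q$ such that the labels of the children of each node of depth $n$ with label $p$ form a set in $\mathrm{DNF}(\varrho(p)(w_n))$; it is accepting if all its infinite branches visit $F$ infinitely often. $L_M(q)$ is the set of words with an accepting run from $q$; $L_M$ extends to $\mathcal B^+(Q)$ by $\cup$ and $\cap$, and $L(M)=L_M(\iota)$. $M$ is nondeterministic (an NBA) if $\land$ occurs neither in $\iota$ nor in $\varrho$. Derivatives are the transition terms $\delta(\top)=\top$, $\delta(\bot)=\bot$, $\delta(\alpha)=(\alpha\,?\,\top:\bot)$ for other predicates, $\delta(\lnot\varphi)=\lnot\delta(\varphi)$, $\delta(\varphi\land\psi)=\delta(\varphi)\land\delta(\psi)$, $\delta(\varphi\lor\psi)=\delta(\varphi)\lor\delta(\psi)$, $\delta(\mathsf X\psi)=\psi$, $\delta(\varphi\,\mathsf U\,\psi)=\delta(\psi)\lor(\delta(\varphi)\land(\varphi\,\mathsf U\,\psi))$, $\delta(\varphi\,\mathsf R\,\psi)=\delta(\psi)\land(\delta(\varphi)\lor(\varphi\,\mathsf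 R\,\psi))$. For $\varphi\in\mathrm{LTL}^+[\mathcal A]$, $M_\varphi=(\mathcal A,Q_\varphi,\varphi,\delta,F_\varphi)$, where $Q_\varphi$ consists of $\bot$, $\top$ and the subformulas of $\varphi$ that are predicates or modal formulas ($\mathsf X,\mathsf U,\mathsf R$), and $F_\varphi$ consists of $\top$ and the $\mathsf R$-formulas in $Q_\varphi$. Alternation elimination: for $M$ as above, $\mathrm{AElim}(M)$ has as states the pairs $\langle U,V\rangle\in 2^Q\times 2^Q$ reachable from the initial ones $\{\langle X\setminus F,X\cap F\rangle\mid X\in\mathrm{DNF}(\iota)\}$, where the transition term $\sigma(\langle U,V\rangle)$, with sets of pairs as leaves, is obtained from $\mathbf f_U=\mathrm{DNF}(\bigwedge_{q\in U}\varrho(q))$ and $\mathbf f_V$ (defined in the same way, and $\mathbf f_\emptyset=\{\emptyset\}$) by lifting the operation $(\mathbf x,\mathbf y)\mapsto\{\langle X\setminus F,\,Y\cup(X\cap F)\rangle\mid X\in\mathbf x,Y\in\mathbf y\}$ if $U\neq\emptyset$, and from $\mathbf f_V$ alone by lifting $\mathbf x\mapsto\{\langle X\setminus F,X\cap F\rangle\mid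 X\in\mathbf x\}$ if $U=\emptyset$; the successors of $\langle U,V\rangle$ are the members of the leaves of this term. A set of pairs stands for the disjunction of its members, and the accepting states are those with $U=\emptyset$. **Theorem.** (1) For all $\varphi\in\mathrm{LTL}^+[\mathcal A]$ and every state $\psi$ of $M_\varphi$: $L_{M_\varphi}(\psi)=L(\psi)$. (2) For all $\varphi\in\mathrm{LTL}^+[\mathcal A]$ and every state $\langle U,V\rangle$ of $N=\mathrm{AElim}(M_\varphi)$: $L_N(\langle U,V\rangle)=L\big(\bigwedge(U\cup V)\big)$ (with $\bigwedge\emptyset=\top$). (3) For all $\varphi\in\mathrm{LTL}^+[\mathcal A]$, $\mathrm{AElim}(M_\varphi)$ is a nondeterministic Büchi automaton modulo $\mathcal A$ and $L(\mathrm{AElim}(M_\varphi))=L(\varphi)$. Consequently, for every $\varphi\in\mathrm{LTL}[\mathcal A]$ with negation normal form $\varphi^+\in\mathrm{LTL}^+[\mathcal A]$ (negations pushed inwards by duality and into the predicates), $\mathrm{AElim}(M_{\varphi^+})$ is a nondeterministic Büchi automaton modulo $\mathcal A$ with language $L(\varphi)$. -/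

import Mathlib

namespace LTLModulo

open scoped Classical

universe u v

/-- A Boolean algebra of predicates `Ψ` over a domain `D` of elements, with its denotation
function.  (Computability of the connectives and decidability of satisfiability play no role
for languages and are not required.) -/
structure ElementAlgebra (D : Type u) (Ψ : Type v) where
  den : Ψ → Set D
  bot : Ψ
  top : Ψ
  or : Ψ → Ψ → Ψ
  and : Ψ → Ψ → Ψ
  not : Ψ → Ψ
  den_bot : den bot = ∅
  den_top : den top = Set.univ
  den_or : ∀ α β, den (or α β) = den α ∪ den β
  den_and : ∀ α β, den (and α β) = den α ∩ den β
  den_not : ∀ α, den (not α) = (den α)ᶜ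

/-! ### Positive Boolean combinations -/

/-- Positive Boolean combinations over `X`. -/
inductive BCp (X : Type u) : Type u
  | top : BCp X
  | bot : BCp X
  | atom : X → BCp X
  | and : BCp X → BCp X → BCp X
  | or : BCp X → BCp X → BCp X

namespace BCp

variable {X : Type u}

/-- Conjunction, in which `⊤` is the unit and `⊥` the zero. -/
def mkAnd : BCp X → BCp X → BCp X
  | top, s => s
  | bot, _ => bot
  | s, top => s
  | _, bot => bot
  | s, t => and s t

/-- Disjunction, in which `⊥` is the unit and `⊤` the zero. -/
def mkOr : BCp X → BCp X → BCp X
  | top, _ => top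
  | bot, s => s
  | _, top => top
  | s, bot => s
  | s, t => or s t

/-- The elements of `X` that occur in a combination. -/
def atoms : BCp X → Set X
  | top => ∅
  | bot => ∅
  | atom q => {q}
  | and s t => atoms s ∪ atoms t
  | or s t => atoms s ∪ atoms t

/-- `∧` does not occur. -/
def NoAnd : BCp X → Prop
  | top => True
  | bot => True
  | atom _ => True
  | and _ _ => False
  | or s t => NoAnd s ∧ NoAnd t

/-- Conjunction of disjunctive normal forms in set-of-sets representation. -/
noncomputable def dnfAnd (s t : Finset (Finset X)) : Finset (Finset X) :=
  Finset.image₂ (fun x y => x ∪ y) s t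

/-- Disjunctive normal form in set-of-sets representation. -/
noncomputable def dnf : BCp X → Finset (Finset X)
  | top => {∅}
  | bot => ∅
  | atom q => {{q}}
  | and s t => dnfAnd (dnf s) (dnf t)
  | or s t => dnf s ∪ dnf t

/-- The disjunction of the elements of a finite set. -/
noncomputable def disj (B : Finset X) : BCp X :=
  B.toList.foldr (fun q s => mkOr (atom q) s) bot

theorem atoms_mkAnd (s t : BCp X) : (mkAnd s t).atoms ⊆ s.atoms ∪ t.atoms := by
  cases s <;> cases t <;> simp [mkAnd, atoms]

theorem atoms_mkOr (s t : BCp X) : (mkOr s t).atoms ⊆ s.atoms ∪ t.atoms := by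
  cases s <;> cases t <;> simp [mkOr, atoms]

theorem atoms_disj (B : Finset X) : (disj B).atoms ⊆ (B : Set X) := by
  have h : ∀ l : List X,
      (l.foldr (fun q s => mkOr (atom q) s) bot).atoms ⊆ {q | q ∈ l} := by
    intro l
    induction l with
    | nil => simp [atoms]
    | cons a l ih =>
      refine (atoms_mkOr _ _).trans ?_
      rintro x (hx | hx)
      · simp only [atoms, Set.mem_singleton_iff] at hx
        simp [hx]
      · have := ih hx
        exact List.mem_cons_of_mem a this
  intro x hx
  simpa using h _ hx

theorem subset_atoms_of_mem_dnf (s : BCp X) :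
    ∀ Z ∈ s.dnf, (Z : Set X) ⊆ s.atoms := by
  induction s with
  | top => simp [dnf]
  | bot => simp [dnf]
  | atom q => simp [dnf, atoms]
  | and s t ihs iht =>
    intro Z hZ
    simp only [dnf, dnfAnd, Finset.mem_image₂] at hZ
    obtain ⟨a, ha, b, hb, rfl⟩ := hZ
    rw [Finset.coe_union]
    exact Set.union_subset_union (ihs a ha) (iht b hb)
  | or s t ihs iht =>
    intro Z hZ
    simp only [dnf, Finset.mem_union] at hZ
    rcases hZ with h | h
    · exact (ihs Z h).trans Set.subset_union_left
    · exact (iht Z h).trans Set.subset_union_right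

end BCp

/-! ### Transition terms -/

/-- Transition terms: nested if-then-else expressions with conditions in `Ψ`, leaves in `L`. -/
inductive TT (Ψ : Type v) (L : Type u) : Type (max u v)
  | leaf : L → TT Ψ L
  | ite : Ψ → TT Ψ L → TT Ψ L → TT Ψ L

namespace TT

variable {D : Type*} {Ψ : Type*} {L L' L'' : Type*}

/-- The leaf of a transition term for an element `a`. -/
noncomputable def leafOf (A : ElementAlgebra D Ψ) : TT Ψ L → D → L
  | leaf l, _ => l
  | ite α f g, a => if a ∈ A.den α then leafOf A f a else leafOf A g a

/-- The set of all leaves. -/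
def leaves : TT Ψ L → Set L
  | leaf l => {l}
  | ite _ f g => leaves f ∪ leaves g

/-- Lifting of a unary operation on leaves. -/
def map (op : L → L') : TT Ψ L → TT Ψ L'
  | leaf l => leaf (op l)
  | ite α f g => ite α (map op f) (map op g)

/-- Lifting of a binary operation on leaves. -/
def map₂ (op : L → L' → L'') : TT Ψ L → TT Ψ L' → TT Ψ L''
  | leaf l, h => map (op l) h
  | ite α f g, h => ite α (map₂ op f h) (map₂ op g h)

theorem leaves_map (op : L → L') (f : TT Ψ L) : (f.map op).leaves = op '' f.leaves := by
  induction f with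
  | leaf l => simp [map, leaves]
  | ite α f g ihf ihg => simp [map, leaves, ihf, ihg, Set.image_union]

theorem leaves_map₂ (op : L → L' → L'') (f : TT Ψ L) (h : TT Ψ L') :
    (map₂ op f h).leaves = Set.image2 op f.leaves h.leaves := by
  induction f with
  | leaf l => simp [map₂, leaves, leaves_map]
  | ite α f g ihf ihg => simp [map₂, leaves, ihf, ihg, Set.image2_union_left]

end TT

/-! ### Alternating Büchi automata -/

/-- An alternating Büchi automaton modulo `A`.  Its states form a finite subset `Q` of the
type `X`; the values of `tf` outside of `Q` are irrelevant.  The constants `⊤` and `⊥` of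
`BCp X` are no states: they stand for acceptance and rejection of every word. -/
structure ABA {D : Type*} {Ψ : Type*} (A : ElementAlgebra D Ψ) (X : Type*) where
  Q : Set X
  init : BCp X
  tf : X → TT Ψ (BCp X)
  F : Set X
  finite_Q : Q.Finite
  init_mem : init.atoms ⊆ Q
  tf_mem : ∀ q ∈ Q, ∀ s ∈ (tf q).leaves, s.atoms ⊆ Q
  F_subset : F ⊆ Q

/-- A tree labelled in `X`: a nonempty set of nodes in `ℕ*`, closed under parents. -/
structure LabelledTree (X : Type*) where
  nodes : Set (List ℕ)
  root_mem : [] ∈ nodes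
  parent_mem : ∀ x k, x ++ [k] ∈ nodes → x ∈ nodes
  label : List ℕ → X

namespace ABA

variable {D : Type*} {Ψ : Type*} {A : ElementAlgebra D Ψ} {X : Type*}

/-- `t` is a run of `M` for the word `w` from `q`: the root has label `q`, and the labels of
the children of a node at depth `n` form a set in the disjunctive normal form of the leaf, for
the letter `w n`, of the transition term of the label of the node. -/
def IsRun (M : ABA A X) (w : ℕ → D) (q : X) (t : LabelledTree X) : Prop :=
  t.label [] = q ∧ ∀ x ∈ t.nodes,
    ∃ Z ∈ ((M.tf (t.label x)).leafOf A (w x.length)).dnf,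
      {p | ∃ k, x ++ [k] ∈ t.nodes ∧ t.label (x ++ [k]) = p} = (Z : Set X)

/-- All infinite branches visit `F` infinitely often. -/
def IsAccepting (M : ABA A X) (t : LabelledTree X) : Prop :=
  ∀ b : ℕ → ℕ, (∀ n, (List.range n).map b ∈ t.nodes) →
    ∃ᶠ n in Filter.atTop, t.label ((List.range n).map b) ∈ M.F

/-- The language of a state. -/
def stateLang (M : ABA A X) (q : X) : Set (ℕ → D) :=
  {w | ∃ t, M.IsRun w q t ∧ M.IsAccepting t}

/-- The language of a positive Boolean combination of states. -/
def combLang (M : ABA A X) : BCp X → Set (ℕ → D)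
  | .top => Set.univ
  | .bot => ∅
  | .atom q => M.stateLang q
  | .and s t => M.combLang s ∩ M.combLang t
  | .or s t => M.combLang s ∪ M.combLang t

/-- The language of an automaton. -/
def lang (M : ABA A X) : Set (ℕ → D) := M.combLang M.init

/-- `M` is a nondeterministic Büchi automaton: `∧` occurs neither in the initial combination
nor in the transition function. -/
def IsNondeterministic (M : ABA A X) : Prop :=
  M.init.NoAnd ∧ ∀ q ∈ M.Q, ∀ s ∈ (M.tf q).leaves, s.NoAnd

/-! ### Alternation elimination -/

/-- The transition term of a state in INF normal form. -/
noncomputable def tfINF (M : ABA A X) (q : X) : TT Ψ (Finset (Finset X)) :=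
  (M.tf q).map BCp.dnf

/-- The conjunction of the terms `tfINF q` for `q ∈ U`; the leaf `{∅}` if `U = ∅`. -/
noncomputable def tfINFSet (M : ABA A X) (U : Finset X) : TT Ψ (Finset (Finset X)) :=
  U.toList.foldr (fun q f => TT.map₂ BCp.dnfAnd (M.tfINF q) f) (TT.leaf {∅})

/-- Alternation product of leaves: all `⟨Z \ F, Y ∪ (Z ∩ F)⟩` with `Z ∈ a`, `Y ∈ b`. -/
noncomputable def altProd (M : ABA A X) (a b : Finset (Finset X)) :
    Finset (Finset X × Finset X) :=
  Finset.image₂ (fun Z Y => (Z.filter (· ∉ M.F), Y ∪ Z.filter (· ∈ M.F))) a b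

/-- All `⟨Z \ F, Z ∩ F⟩` with `Z ∈ a`. -/
noncomputable def split (M : ABA A X) (a : Finset (Finset X)) :
    Finset (Finset X × Finset X) :=
  a.image (fun Z => (Z.filter (· ∉ M.F), Z.filter (· ∈ M.F)))

/-- The transition term that alternation elimination assigns to `⟨U, V⟩`. -/
noncomputable def elimTerm (M : ABA A X) (s : Finset X × Finset X) :
    TT Ψ (Finset (Finset X × Finset X)) :=
  if s.1 = ∅ then (M.tfINFSet s.2).map M.split
  else TT.map₂ M.altProd (M.tfINFSet s.1) (M.tfINFSet s.2)

/-- The states found by the alternation elimination algorithm: the initial ones, and all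
members of leaves of transition terms of states already found. -/
inductive ElimState (M : ABA A X) : Finset X × Finset X → Prop
  | init (p : Finset X × Finset X) : p ∈ M.split M.init.dnf → ElimState M p
  | step (s p : Finset X × Finset X) (B : Finset (Finset X × Finset X)) :
      ElimState M s → B ∈ (M.elimTerm s).leaves → p ∈ B → ElimState M p

theorem tfINFSet_subset (M : ABA A X) (U : Finset X) (hU : (U : Set X) ⊆ M.Q) :
    ∀ a ∈ (M.tfINFSet U).leaves, ∀ Z ∈ a, (Z : Set X) ⊆ M.Q := by
  have h : ∀ l : List X, (∀ q ∈ l, q ∈ M.Q) →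
      ∀ a ∈ (l.foldr (fun q f => TT.map₂ BCp.dnfAnd (M.tfINF q) f)
        (TT.leaf {∅} : TT Ψ (Finset (Finset X)))).leaves,
        ∀ Z ∈ a, (Z : Set X) ⊆ M.Q := by
    intro l
    induction l with
    | nil =>
      intro _ a ha Z hZ
      simp only [List.foldr_nil, TT.leaves, Set.mem_singleton_iff] at ha
      subst ha
      simp only [Finset.mem_singleton] at hZ
      simp [hZ]
    | cons q l ih =>
      intro hl a ha Z hZ
      simp only [List.foldr_cons, TT.leaves_map₂, tfINF, TT.leaves_map] at ha
      obtain ⟨_, ⟨s, hs, rfl⟩, c, hc, rfl⟩ := ha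
      simp only [BCp.dnfAnd, Finset.mem_image₂] at hZ
      obtain ⟨x, hx, y, hy, rfl⟩ := hZ
      rw [Finset.coe_union]
      refine Set.union_subset ?_ (ih (fun p hp => hl p (by simp [hp])) c hc y hy)
      exact (s.subset_atoms_of_mem_dnf x hx).trans (M.tf_mem q (hl q (by simp)) s hs)
  exact h _ (fun q hq => hU (by simpa using hq))

theorem ElimState.subset {M : ABA A X} {p : Finset X × Finset X} (h : M.ElimState p) :
    (p.1 : Set X) ⊆ M.Q ∧ (p.2 : Set X) ⊆ M.Q := by
  have key : ∀ Z : Finset X, (Z : Set X) ⊆ M.Q → ∀ (P : X → Prop) [DecidablePred P],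
      ((Z.filter P : Finset X) : Set X) ⊆ M.Q :=
    fun Z hZ P _ x hx => hZ (Finset.mem_coe.2 (Finset.mem_filter.1 (Finset.mem_coe.1 hx)).1)
  have hsplit : ∀ a : Finset (Finset X), (∀ Z ∈ a, (Z : Set X) ⊆ M.Q) → ∀ p ∈ M.split a,
      (p.1 : Set X) ⊆ M.Q ∧ (p.2 : Set X) ⊆ M.Q := by
    intro a ha p hp
    simp only [split, Finset.mem_image] at hp
    obtain ⟨Z, hZ, rfl⟩ := hp
    exact ⟨key Z (ha Z hZ) (· ∉ M.F), key Z (ha Z hZ) (· ∈ M.F)⟩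
  induction h with
  | init p hp =>
    exact hsplit _ (fun Z hZ => (M.init.subset_atoms_of_mem_dnf Z hZ).trans M.init_mem) p hp
  | step s p B _ hB hp ih =>
    unfold elimTerm at hB
    split_ifs at hB with hs
    · rw [TT.leaves_map] at hB
      obtain ⟨a, ha, rfl⟩ := hB
      exact hsplit a (M.tfINFSet_subset s.2 ih.2 a ha) p hp
    · rw [TT.leaves_map₂] at hB
      obtain ⟨a, ha, b, hb, rfl⟩ := hB
      simp only [altProd, Finset.mem_image₂] at hp
      obtain ⟨Z, hZ, Y, hY, rfl⟩ := hp
      have h1 := M.tfINFSet_subset s.1 ih.1 a ha Z hZ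
      have h2 := M.tfINFSet_subset s.2 ih.2 b hb Y hY
      refine ⟨key Z h1 (· ∉ M.F), ?_⟩
      simp only [Finset.coe_union]
      exact Set.union_subset h2 (key Z h1 (· ∈ M.F))

theorem finite_elimState (M : ABA A X) : {p | M.ElimState p}.Finite := by
  have hf : ((M.finite_Q.toFinset.powerset ×ˢ M.finite_Q.toFinset.powerset :
      Finset (Finset X × Finset X)) : Set (Finset X × Finset X)).Finite :=
    Finset.finite_toSet _
  refine hf.subset ?_
  intro p hp
  have h := ElimState.subset hp
  simp only [Finset.coe_product, Set.mem_prod, Finset.mem_coe, Finset.mem_powerset]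
  constructor
  · intro x hx
    exact (Set.Finite.mem_toFinset _).2 (h.1 hx)
  · intro x hx
    exact (Set.Finite.mem_toFinset _).2 (h.2 hx)

/-- Alternation elimination.  A set of states that is a leaf stands for the disjunction of its
members. -/
noncomputable def elim (M : ABA A X) : ABA A (Finset X × Finset X) where
  Q := {p | M.ElimState p}
  init := BCp.disj (M.split M.init.dnf)
  tf := fun s => (M.elimTerm s).map BCp.disj
  F := {p | M.ElimState p ∧ p.1 = ∅}
  finite_Q := M.finite_elimState
  init_mem := fun p hp => ElimState.init p (by simpa using BCp.atoms_disj _ hp)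
  tf_mem := by
    intro s hs t ht p hp
    rw [TT.leaves_map] at ht
    obtain ⟨B, hB, rfl⟩ := ht
    exact ElimState.step s p B hs hB (by simpa using BCp.atoms_disj _ hp)
  F_subset := fun _ hp => hp.1

end ABA

/-! ### Linear temporal logic -/

/-- Formulas of linear temporal logic over predicates in `Ψ`. -/
inductive LTL (Ψ : Type v) : Type v
  | pred : Ψ → LTL Ψ
  | not : LTL Ψ → LTL Ψ
  | or : LTL Ψ → LTL Ψ → LTL Ψ
  | and : LTL Ψ → LTL Ψ → LTL Ψ
  | next : LTL Ψ → LTL Ψ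
  | untl : LTL Ψ → LTL Ψ → LTL Ψ
  | release : LTL Ψ → LTL Ψ → LTL Ψ

namespace LTL

variable {D : Type*} {Ψ : Type*}

/-- The suffix of `w` that starts at position `n`. -/
def rest (n : ℕ) (w : ℕ → D) : ℕ → D := fun i => w (n + i)

/-- `w` is a model of a formula. -/
def Models (A : ElementAlgebra D Ψ) : (ℕ → D) → LTL Ψ → Prop
  | w, pred α => w 0 ∈ A.den α
  | w, not φ => ¬ Models A w φ
  | w, or φ ψ => Models A w φ ∨ Models A w ψ
  | w, and φ ψ => Models A w φ ∧ Models A w ψ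
  | w, next φ => Models A (rest 1 w) φ
  | w, untl φ ψ => ∃ j, Models A (rest j w) ψ ∧ ∀ i < j, Models A (rest i w) φ
  | w, release φ ψ => (∀ j, Models A (rest j w) ψ) ∨
      ∃ j, Models A (rest j w) φ ∧ ∀ i ≤ j, Models A (rest i w) ψ

/-- The language of a formula. -/
def lang (A : ElementAlgebra D Ψ) (φ : LTL Ψ) : Set (ℕ → D) := {w | Models A w φ}

/-- `¬` does not occur (the negation inside of predicates does not count). -/
def Positive : LTL Ψ → Prop
  | pred _ => True
  | not _ => False
  | or φ ψ => Positive φ ∧ Positive ψ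
  | and φ ψ => Positive φ ∧ Positive ψ
  | next φ => Positive φ
  | untl φ ψ => Positive φ ∧ Positive ψ
  | release φ ψ => Positive φ ∧ Positive ψ

/-- Negation normal form of `φ` (for `true`) and of the negation of `φ` (for `false`). -/
def nnf (A : ElementAlgebra D Ψ) : Bool → LTL Ψ → LTL Ψ
  | true, pred α => pred α
  | false, pred α => pred (A.not α)
  | b, not φ => nnf A (!b) φ
  | true, or φ ψ => or (nnf A true φ) (nnf A true ψ)
  | false, or φ ψ => and (nnf A false φ) (nnf A false ψ)
  | true, and φ ψ => and (nnf A true φ) (nnf A true ψ)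
  | false, and φ ψ => or (nnf A false φ) (nnf A false ψ)
  | b, next φ => next (nnf A b φ)
  | true, untl φ ψ => untl (nnf A true φ) (nnf A true ψ)
  | false, untl φ ψ => release (nnf A false φ) (nnf A false ψ)
  | true, release φ ψ => release (nnf A true φ) (nnf A true ψ)
  | false, release φ ψ => untl (nnf A false φ) (nnf A false ψ)

theorem nnf_positive (A : ElementAlgebra D Ψ) (φ : LTL Ψ) :
    ∀ b, (nnf A b φ).Positive := by
  induction φ with
  | pred α => intro b; cases b <;> simp [nnf, Positive]
  | not φ ih => intro b; simpa [nnf] using ih (!b)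
  | next φ ih => intro b; cases b <;> simpa [nnf, Positive] using ih _
  | or φ ψ ih1 ih2 => intro b; cases b <;> simpa [nnf, Positive] using ⟨ih1 _, ih2 _⟩
  | and φ ψ ih1 ih2 => intro b; cases b <;> simpa [nnf, Positive] using ⟨ih1 _, ih2 _⟩
  | untl φ ψ ih1 ih2 => intro b; cases b <;> simpa [nnf, Positive] using ⟨ih1 _, ih2 _⟩
  | release φ ψ ih1 ih2 => intro b; cases b <;> simpa [nnf, Positive] using ⟨ih1 _, ih2 _⟩

/-- The symbolic derivative of a formula. -/
noncomputable def deriv (A : ElementAlgebra D Ψ) : LTL Ψ → TT Ψ (LTL Ψ)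
  | pred α =>
      if α = A.top then .leaf (pred A.top)
      else if α = A.bot then .leaf (pred A.bot)
      else .ite α (.leaf (pred A.top)) (.leaf (pred A.bot))
  | and φ ψ => TT.map₂ and (deriv A φ) (deriv A ψ)
  | or φ ψ => TT.map₂ or (deriv A φ) (deriv A ψ)
  | not φ => (deriv A φ).map not
  | next φ => .leaf φ
  | untl φ ψ => TT.map₂ or (deriv A ψ) (TT.map₂ and (deriv A φ) (.leaf (untl φ ψ)))
  | release φ ψ => TT.map₂ and (deriv A ψ) (TT.map₂ or (deriv A φ) (.leaf (release φ ψ)))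

/-- A positive formula as a positive Boolean combination of predicates and modal formulas,
where the formulas `⊤` and `⊥` become the constants `⊤` and `⊥`.  (Formulas `¬ φ`, irrelevant
here, are kept.) -/
noncomputable def toBCp (A : ElementAlgebra D Ψ) : LTL Ψ → BCp (LTL Ψ)
  | pred α => if α = A.top then .top else if α = A.bot then .bot else .atom (pred α)
  | and φ ψ => .mkAnd (toBCp A φ) (toBCp A ψ)
  | or φ ψ => .mkOr (toBCp A φ) (toBCp A ψ)
  | not φ => .atom (not φ)
  | next φ => .atom (next φ)
  | untl φ ψ => .atom (untl φ ψ)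
  | release φ ψ => .atom (release φ ψ)

/-- The non-Boolean subformulas: predicates and modal formulas. -/
def subs : LTL Ψ → Set (LTL Ψ)
  | pred α => {pred α}
  | not φ => subs φ
  | or φ ψ => subs φ ∪ subs ψ
  | and φ ψ => subs φ ∪ subs ψ
  | next φ => {next φ} ∪ subs φ
  | untl φ ψ => {untl φ ψ} ∪ (subs φ ∪ subs ψ)
  | release φ ψ => {release φ ψ} ∪ (subs φ ∪ subs ψ)

/-- The states of the automaton of `φ`. -/
def states (A : ElementAlgebra D Ψ) (φ : LTL Ψ) : Set (LTL Ψ) :=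
  {pred A.bot, pred A.top} ∪ subs φ

def IsRelease : LTL Ψ → Prop
  | release _ _ => True
  | _ => False

/-- The formula that is the conjunction of a finite set of formulas (`⊤` if it is empty). -/
noncomputable def conj (A : ElementAlgebra D Ψ) (U : Finset (LTL Ψ)) : LTL Ψ :=
  U.toList.foldr and (pred A.top)

/-- The conjunction of `U ∪ V` for a pair `⟨U, V⟩`. -/
noncomputable def pairConj (A : ElementAlgebra D Ψ) (q : Finset (LTL Ψ) × Finset (LTL Ψ)) :
    LTL Ψ :=
  conj A (q.1 ∪ q.2)

end LTL

namespace LTL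

variable {D : Type*} {Ψ : Type*}

theorem finite_subs (φ : LTL Ψ) : (subs φ).Finite := by
  induction φ <;> simp_all [subs, Set.finite_insert]

theorem subs_trans (φ : LTL Ψ) : ∀ q ∈ subs φ, subs q ⊆ subs φ := by
  induction φ with
  | pred α => rintro q rfl; exact subset_rfl
  | not φ ih => exact ih
  | or φ ψ ih1 ih2 =>
    rintro q (h | h)
    · exact (ih1 q h).trans Set.subset_union_left
    · exact (ih2 q h).trans Set.subset_union_right
  | and φ ψ ih1 ih2 =>
    rintro q (h | h)
    · exact (ih1 q h).trans Set.subset_union_left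
    · exact (ih2 q h).trans Set.subset_union_right
  | next φ ih =>
    rintro q (rfl | h)
    · exact subset_rfl
    · exact (ih q h).trans Set.subset_union_right
  | untl φ ψ ih1 ih2 =>
    rintro q (rfl | h | h)
    · exact subset_rfl
    · exact ((ih1 q h).trans Set.subset_union_left).trans Set.subset_union_right
    · exact ((ih2 q h).trans Set.subset_union_right).trans Set.subset_union_right
  | release φ ψ ih1 ih2 =>
    rintro q (rfl | h | h)
    · exact subset_rfl
    · exact ((ih1 q h).trans Set.subset_union_left).trans Set.subset_union_right
    · exact ((ih2 q h).trans Set.subset_union_right).trans Set.subset_union_right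

theorem positive_of_mem_subs (φ : LTL Ψ) : φ.Positive → ∀ q ∈ subs φ, q.Positive := by
  induction φ with
  | pred α => rintro h q rfl; exact h
  | not φ ih => intro h; exact h.elim
  | or φ ψ ih1 ih2 =>
    rintro ⟨h1, h2⟩ q (h | h)
    · exact ih1 h1 q h
    · exact ih2 h2 q h
  | and φ ψ ih1 ih2 =>
    rintro ⟨h1, h2⟩ q (h | h)
    · exact ih1 h1 q h
    · exact ih2 h2 q h
  | next φ ih =>
    rintro h q (rfl | h')
    · exact h
    · exact ih h q h'
  | untl φ ψ ih1 ih2 =>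
    rintro h q (rfl | h' | h')
    · exact h
    · exact ih1 h.1 q h'
    · exact ih2 h.2 q h'
  | release φ ψ ih1 ih2 =>
    rintro h q (rfl | h' | h')
    · exact h
    · exact ih1 h.1 q h'
    · exact ih2 h.2 q h'

theorem atoms_toBCp (A : ElementAlgebra D Ψ) (φ : LTL Ψ) :
    φ.Positive → (toBCp A φ).atoms ⊆ subs φ := by
  induction φ with
  | pred α => intro _; unfold toBCp; split_ifs <;> simp [BCp.atoms, subs]
  | not φ ih => intro h; exact h.elim
  | or φ ψ ih1 ih2 =>
    rintro ⟨h1, h2⟩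
    exact (BCp.atoms_mkOr _ _).trans (Set.union_subset_union (ih1 h1) (ih2 h2))
  | and φ ψ ih1 ih2 =>
    rintro ⟨h1, h2⟩
    exact (BCp.atoms_mkAnd _ _).trans (Set.union_subset_union (ih1 h1) (ih2 h2))
  | next φ ih => intro _; simp [toBCp, BCp.atoms, subs]
  | untl φ ψ ih1 ih2 => intro _; simp [toBCp, BCp.atoms, subs]
  | release φ ψ ih1 ih2 => intro _; simp [toBCp, BCp.atoms, subs]

theorem atoms_deriv (A : ElementAlgebra D Ψ) (φ : LTL Ψ) :
    φ.Positive → ∀ l ∈ (deriv A φ).leaves, (toBCp A l).atoms ⊆ subs φ := by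
  have htop : (toBCp A (pred A.top)).atoms = ∅ := by simp [toBCp, BCp.atoms]
  have hbot : (toBCp A (pred A.bot)).atoms = ∅ := by
    unfold toBCp; split_ifs <;> simp_all [BCp.atoms]
  induction φ with
  | pred α =>
    intro _ l hl
    unfold deriv at hl
    split_ifs at hl <;> simp only [TT.leaves, Set.mem_union, Set.mem_singleton_iff] at hl
    · subst hl; simp [htop]
    · subst hl; simp [hbot]
    · rcases hl with rfl | rfl
      · simp [htop]
      · simp [hbot]
  | not φ ih => intro h; exact h.elim
  | or φ ψ ih1 ih2 =>
    rintro ⟨h1, h2⟩ l hl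
    simp only [deriv, TT.leaves_map₂] at hl
    obtain ⟨a, ha, b, hb, rfl⟩ := hl
    exact (BCp.atoms_mkOr _ _).trans (Set.union_subset_union (ih1 h1 a ha) (ih2 h2 b hb))
  | and φ ψ ih1 ih2 =>
    rintro ⟨h1, h2⟩ l hl
    simp only [deriv, TT.leaves_map₂] at hl
    obtain ⟨a, ha, b, hb, rfl⟩ := hl
    exact (BCp.atoms_mkAnd _ _).trans (Set.union_subset_union (ih1 h1 a ha) (ih2 h2 b hb))
  | next φ ih =>
    intro h l hl
    simp only [deriv, TT.leaves, Set.mem_singleton_iff] at hl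
    subst hl
    exact (atoms_toBCp A l h).trans Set.subset_union_right
  | untl φ ψ ih1 ih2 =>
    rintro ⟨h1, h2⟩ l hl
    simp only [deriv, TT.leaves_map₂, TT.leaves] at hl
    obtain ⟨a, ha, _, ⟨b, hb, c, hc, rfl⟩, rfl⟩ := hl
    rw [Set.mem_singleton_iff] at hc
    subst hc
    refine (BCp.atoms_mkOr _ _).trans (Set.union_subset ?_
      ((BCp.atoms_mkAnd _ _).trans (Set.union_subset ?_ ?_)))
    · exact ((ih2 h2 a ha).trans Set.subset_union_right).trans Set.subset_union_right
    · exact ((ih1 h1 b hb).trans Set.subset_union_left).trans Set.subset_union_right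
    · simp [toBCp, BCp.atoms, subs]
  | release φ ψ ih1 ih2 =>
    rintro ⟨h1, h2⟩ l hl
    simp only [deriv, TT.leaves_map₂, TT.leaves] at hl
    obtain ⟨a, ha, _, ⟨b, hb, c, hc, rfl⟩, rfl⟩ := hl
    rw [Set.mem_singleton_iff] at hc
    subst hc
    refine (BCp.atoms_mkAnd _ _).trans (Set.union_subset ?_
      ((BCp.atoms_mkOr _ _).trans (Set.union_subset ?_ ?_)))
    · exact ((ih2 h2 a ha).trans Set.subset_union_right).trans Set.subset_union_right
    · exact ((ih1 h1 b hb).trans Set.subset_union_left).trans Set.subset_union_right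
    · simp [toBCp, BCp.atoms, subs]

/-- The alternating Büchi automaton of a positive formula. -/
noncomputable def toABA (A : ElementAlgebra D Ψ) (φ : LTL Ψ) (hφ : φ.Positive) :
    ABA A (LTL Ψ) where
  Q := states A φ
  init := toBCp A φ
  tf := fun q => (deriv A q).map (toBCp A)
  F := {q | q ∈ states A φ ∧ (q.IsRelease ∨ q = pred A.top)}
  finite_Q := ((Set.finite_singleton _).insert _).union (finite_subs φ)
  init_mem := (atoms_toBCp A φ hφ).trans Set.subset_union_right
  tf_mem := by
    intro q hq s hs
    rw [TT.leaves_map] at hs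
    obtain ⟨l, hl, rfl⟩ := hs
    rcases hq with (rfl | rfl) | hq
    · refine (atoms_deriv A (pred _) trivial l hl).trans ?_
      intro x hx
      simp only [subs, Set.mem_singleton_iff] at hx
      simp [states, hx]
    · refine (atoms_deriv A (pred _) trivial l hl).trans ?_
      intro x hx
      simp only [subs, Set.mem_singleton_iff] at hx
      simp [states, hx]
    · exact ((atoms_deriv A q (positive_of_mem_subs φ hφ q hq) l hl).trans
        (subs_trans φ q hq)).trans Set.subset_union_right
  F_subset := fun _ hq => hq.1

/-- The translation of formulas to nondeterministic Büchi automata: negation normal form,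
symbolic derivatives, alternation elimination. -/
noncomputable def toNBA (A : ElementAlgebra D Ψ) (φ : LTL Ψ) :
    ABA A (Finset (LTL Ψ) × Finset (LTL Ψ)) :=
  (toABA A (nnf A true φ) (nnf_positive A φ true)).elim

end LTL

end LTLModulo

/-! A formula holds at position `n` iff its derivative by the letter `w n` holds at position `n +
1`. Following transitions therefore preserves truth in both directions; only the acceptance
condition needs an argument, and it matters for `U`-formulas alone. General correctness of
alternation elimination is not needed: the languages of both automata are compared with the
semantics of formulas directly, by one argument per direction.

Soundness. An accepting run of `M_φ`, and the elements of the pairs along an accepting run of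
`AElim(M_φ)`, both give a graph of labelled nodes in which successors satisfy the transition term
and every infinite path meets `F` (`IsRun.isRunGraph`, `isRunGraph_of_seq`). In any such graph every
label is true at its depth (`models_of_isRunGraph`), by induction on its size: a false `U`-formula
would be postponed forever along a path outside `F`, while an `R`-formula that is postponed forever
is true.

Completeness. Where a formula is true, true successors can be chosen so that outside the
`R`-formulas the pair (size, distance to fulfilment) decreases lexicographically (`holds_rank_lt`).
This is a positional strategy, and a well-founded rank that decreases outside `F` forces every
branch to meet `F` again and again (`IsStrategy.mem_stateLang`). Moving all elements of a pair `⟨U,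
V⟩` by the strategy, with the largest rank in `U` as rank, gives such a strategy for `AElim(M_φ)`
(`IsStrategy.elim`).

Part (3) follows from (2) at the initial pairs, and the last claim from the semantics of the
negation normal form. -/

namespace LTLModulo

open scoped Classical

/-! ### Positive Boolean combinations: valuations and normal forms -/

namespace BCp

variable {X : Type*}

/-- Satisfaction of a positive Boolean combination by a valuation of its atoms. -/
def Holds (P : X → Prop) : BCp X → Prop
  | top => True
  | bot => False
  | atom q => P q
  | and s t => Holds P s ∧ Holds P t
  | or s t => Holds P s ∨ Holds P t

theorem holds_mkAnd (P : X → Prop) (s t : BCp X) :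
    (mkAnd s t).Holds P ↔ s.Holds P ∧ t.Holds P := by
  cases s <;> cases t <;> simp [mkAnd, Holds]

theorem holds_mkOr (P : X → Prop) (s t : BCp X) :
    (mkOr s t).Holds P ↔ s.Holds P ∨ t.Holds P := by
  cases s <;> cases t <;> simp [mkOr, Holds]

/-- This turns the choice of a successor set in a run into the truth of a combination, and back. -/
theorem holds_iff_exists_mem_dnf (P : X → Prop) (s : BCp X) :
    s.Holds P ↔ ∃ Z ∈ s.dnf, ∀ p ∈ Z, P p := by
  induction s with
  | top => simp [Holds, dnf]
  | bot => simp [Holds, dnf]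
  | atom q => simp [Holds, dnf]
  | and s t ihs iht =>
    simp only [Holds, dnf, dnfAnd, ihs, iht, Finset.mem_image₂]
    constructor
    · rintro ⟨⟨x, hx, hx'⟩, y, hy, hy'⟩
      refine ⟨_, ⟨x, hx, y, hy, rfl⟩, fun p hp => ?_⟩
      exact (Finset.mem_union.1 hp).elim (hx' p) (hy' p)
    · rintro ⟨_, ⟨x, hx, y, hy, rfl⟩, h⟩
      exact ⟨⟨x, hx, fun p hp => h p (Finset.mem_union_left _ hp)⟩,
        y, hy, fun p hp => h p (Finset.mem_union_right _ hp)⟩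
  | or s t ihs iht =>
    simp only [Holds, dnf, ihs, iht, Finset.mem_union]
    constructor
    · rintro (⟨x, hx, h⟩ | ⟨x, hx, h⟩)
      exacts [⟨x, .inl hx, h⟩, ⟨x, .inr hx, h⟩]
    · rintro ⟨x, hx | hx, h⟩
      exacts [.inl ⟨x, hx, h⟩, .inr ⟨x, hx, h⟩]

theorem Holds.mono {P P' : X → Prop} {s : BCp X} (h : s.Holds P)
    (hP : ∀ p ∈ s.atoms, P p → P' p) : s.Holds P' := by
  obtain ⟨Z, hZ, hp⟩ := (holds_iff_exists_mem_dnf P s).1 h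
  exact (holds_iff_exists_mem_dnf P' s).2
    ⟨Z, hZ, fun p h => hP p (s.subset_atoms_of_mem_dnf Z hZ h) (hp p h)⟩

theorem noAnd_disj (B : Finset X) : (disj B).NoAnd := by
  unfold disj
  induction B.toList with
  | nil => trivial
  | cons a l ih =>
    rw [List.foldr_cons]
    revert ih
    cases l.foldr (fun q s => mkOr (atom q) s) bot <;> simp [mkOr, NoAnd]

/-- Hence a node in a run of an eliminated automaton has exactly one successor label, a member of
the leaf. -/
theorem mem_dnf_disj (B : Finset X) (Z : Finset X) :
    Z ∈ (disj B).dnf ↔ ∃ q ∈ B, {q} = Z := by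
  -- The induction also has to exclude `top`, which `mkOr` would let absorb the new atom.
  have h : ∀ l : List X, (Z ∈ (l.foldr (fun q s => mkOr (atom q) s) bot).dnf ↔
      ∃ q ∈ l, {q} = Z) ∧ l.foldr (fun q s => mkOr (atom q) s) bot ≠ top := by
    intro l
    induction l with
    | nil => simp [dnf]
    | cons a l ih =>
      rw [List.foldr_cons, List.exists_mem_cons_iff, ← ih.1]
      obtain ⟨-, ih⟩ := ih
      revert ih
      cases l.foldr (fun q s => mkOr (atom q) s) bot <;> simp [mkOr, dnf, eq_comm]
  simpa [disj] using (h B.toList).1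

end BCp

/-! ### Evaluation of transition terms at a letter -/

namespace TT

variable {D : Type*} {Ψ : Type*} {L L' L'' : Type*}

theorem leafOf_map (A : ElementAlgebra D Ψ) (op : L → L') (f : TT Ψ L) (a : D) :
    (f.map op).leafOf A a = op (f.leafOf A a) := by
  induction f with
  | leaf l => rfl
  | ite α f g ihf ihg => simp only [map, leafOf, ihf, ihg]; split_ifs <;> rfl

theorem leafOf_map₂ (A : ElementAlgebra D Ψ) (op : L → L' → L'') (f : TT Ψ L) (h : TT Ψ L')
    (a : D) : (map₂ op f h).leafOf A a = op (f.leafOf A a) (h.leafOf A a) := by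
  induction f with
  | leaf l => simp [map₂, leafOf, leafOf_map]
  | ite α f g ihf ihg => simp only [map₂, leafOf, ihf, ihg]; split_ifs <;> rfl

theorem leafOf_mem_leaves (A : ElementAlgebra D Ψ) (f : TT Ψ L) (a : D) :
    f.leafOf A a ∈ f.leaves := by
  induction f with
  | leaf l => rfl
  | ite α f g ihf ihg =>
    simp only [leafOf, leaves]
    split_ifs
    exacts [.inl ihf, .inr ihg]

end TT

/-! ### Trees, positional strategies and acceptance -/

namespace LabelledTree

variable {X : Type*}

theorem mem_of_append (t : LabelledTree X) (x y : List ℕ) (h : x ++ y ∈ t.nodes) :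
    x ∈ t.nodes := by
  induction y using List.reverseRecOn with
  | nil => simpa using h
  | append_singleton y k ih => exact ih (t.parent_mem _ k (by simpa using h))

end LabelledTree

namespace ABA

variable {D : Type*} {Ψ : Type*} {A : ElementAlgebra D Ψ} {X : Type*}

/-- A positional strategy: on the configurations satisfying `W`, the successor set `Z` is
permitted, stays in `W`, and decreases the rank `r` along steps outside of `F`. -/
def IsStrategy {O : Type*} [LT O] (M : ABA A X) (w : ℕ → D) (W : ℕ → X → Prop)
    (Z : ℕ → X → Finset X) (r : ℕ → X → O) : Prop :=
  ∀ n q, W n q → Z n q ∈ ((M.tf q).leafOf A (w n)).dnf ∧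
    ∀ p ∈ Z n q, W (n + 1) p ∧ (q ∉ M.F → p ∉ M.F → r (n + 1) p < r n q)

/-- The label of a node, given in reverse, of the tree in which `Z n p` are the labels of the
children of a node with label `p` at depth `n`. -/
noncomputable def unfoldLabel (Z : ℕ → X → Finset X) (q : X) : List ℕ → Option X
  | [] => some q
  | k :: l => (unfoldLabel Z q l).bind fun p => (Z l.length p).toList[k]?

/-- The tree with root label `q` in which `Z n p` are the labels of the children of a node
with label `p` at depth `n`. -/
noncomputable def unfoldTree (Z : ℕ → X → Finset X) (q : X) : LabelledTree X where
  nodes := {x | (unfoldLabel Z q x.reverse).isSome}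
  root_mem := rfl
  parent_mem := by
    intro x k h
    simp only [Set.mem_ofPred_eq, List.reverse_append, List.reverse_singleton,
      List.singleton_append, unfoldLabel, Option.isSome_bind] at h ⊢
    exact Option.isSome_of_any h
  label := fun x => (unfoldLabel Z q x.reverse).getD q

theorem unfoldTree_child (Z : ℕ → X → Finset X) (q : X) {x : List ℕ}
    (hx : x ∈ (unfoldTree Z q).nodes) (p : X) :
    (∃ k, x ++ [k] ∈ (unfoldTree Z q).nodes ∧ (unfoldTree Z q).label (x ++ [k]) = p) ↔
      p ∈ Z x.length ((unfoldTree Z q).label x) := by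
  obtain ⟨c, hc⟩ := Option.isSome_iff_exists.1 hx
  simp only [unfoldTree, Set.mem_ofPred_eq, List.reverse_append, List.reverse_singleton,
    List.singleton_append, unfoldLabel, hc, Option.bind_some, List.length_reverse,
    Option.getD_some]
  rw [← Finset.mem_toList, List.mem_iff_getElem?]
  refine exists_congr fun k => ?_
  cases (Z x.length c).toList[k]? <;> simp

theorem IsStrategy.unfoldTree_mem {O : Type*} [LT O] {M : ABA A X} {w : ℕ → D}
    {W : ℕ → X → Prop} {Z : ℕ → X → Finset X} {r : ℕ → X → O} (h : M.IsStrategy w W Z r)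
    {q : X} (hq : W 0 q) (x : List ℕ) :
    x ∈ (unfoldTree Z q).nodes → W x.length ((unfoldTree Z q).label x) := by
  induction x using List.reverseRecOn with
  | nil => exact fun _ => hq
  | append_singleton x k ih =>
    intro hx
    have hx' := (unfoldTree Z q).parent_mem x k hx
    rw [List.length_append, List.length_singleton]
    exact ((h _ _ (ih hx')).2 _ ((unfoldTree_child Z q hx' _).1 ⟨k, hx, rfl⟩)).1

/-- The tree that unfolds the strategy is a run; on a branch that leaves `F` for good, the ranks
would descend forever. -/
theorem IsStrategy.mem_stateLang {O : Type*} [Preorder O] [WellFoundedLT O] {M : ABA A X}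
    {w : ℕ → D} {W : ℕ → X → Prop} {Z : ℕ → X → Finset X} {r : ℕ → X → O}
    (h : M.IsStrategy w W Z r) {q : X} (hq : W 0 q) : w ∈ M.stateLang q := by
  refine ⟨unfoldTree Z q, ⟨rfl, fun x hx => ⟨_, (h _ _ (h.unfoldTree_mem hq x hx)).1, ?_⟩⟩, ?_⟩
  · ext p
    exact unfoldTree_child Z q hx p
  · intro b hb
    by_contra hF
    rw [Filter.not_frequently, Filter.eventually_atTop] at hF
    obtain ⟨N, hN⟩ := hF
    obtain ⟨m, hm⟩ := WellFounded.not_rel_apply_succ (r := ((· < ·) : O → O → Prop))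
      (fun m => r (N + m) ((unfoldTree Z q).label ((List.range (N + m)).map b)))
    refine hm ?_
    have hn := hb (N + m)
    have hs := hb (N + m + 1)
    have hF := hN (N + m + 1) (by omega)
    rw [List.range_succ, List.map_append] at hs hF
    have hc := (unfoldTree_child Z q hn _).1 ⟨_, hs, rfl⟩
    have := ((h _ _ (h.unfoldTree_mem hq _ hn)).2 _ hc).2 (hN _ (by omega)) hF
    simpa [← add_assoc, List.range_succ] using this

/-- Acceptance, for branches that continue from a given node. -/
theorem IsAccepting.frequently {M : ABA A X} {t : LabelledTree X} (h : M.IsAccepting t)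
    (x : List ℕ) (k : ℕ → ℕ) (hk : ∀ n, x ++ (List.range n).map k ∈ t.nodes) :
    ∃ᶠ n in Filter.atTop, t.label (x ++ (List.range n).map k) ∈ M.F := by
  have hb : ∀ n, (List.range (x.length + n)).map
      (fun i => if i < x.length then x.getD i 0 else k (i - x.length)) =
        x ++ (List.range n).map k := by
    intro n
    apply List.ext_getElem
    · simp
    · intro i h1 h2
      simp only [List.getElem_map, List.getElem_range, List.getElem_append]
      split_ifs with hi
      · simp [hi]
      · rfl
  -- The branch that first walks down to `x` and then follows `k`.
  have hF := h (fun i => if i < x.length then x.getD i 0 else k (i - x.length)) (by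
    intro n
    rcases le_total x.length n with hn | hn
    · obtain ⟨m, rfl⟩ := Nat.exists_eq_add_of_le hn
      rw [hb]
      exact hk m
    -- Above `x` the branch consists of prefixes of `x`, which are nodes by closure under parents.
    · apply t.mem_of_append _ (x.drop n)
      have : (List.range n).map
          (fun i => if i < x.length then x.getD i 0 else k (i - x.length)) = x.take n := by
        apply List.ext_getElem
        · simp [hn]
        · intro i h1 h2
          simp only [List.length_map, List.length_range] at h1
          simp [h1.trans_le hn]
      rw [this, List.take_append_drop]
      simpa using hk 0)
  rw [Filter.frequently_atTop] at hF ⊢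
  intro N
  obtain ⟨n, hn, hF⟩ := hF (x.length + N)
  obtain ⟨m, rfl⟩ := Nat.exists_eq_add_of_le (le_of_add_le_left hn)
  exact ⟨m, by omega, by rwa [hb] at hF⟩

end ABA

/-! ### Alternation elimination: lifted strategies and run graphs -/

namespace ABA

variable {D : Type*} {Ψ : Type*} {A : ElementAlgebra D Ψ} {X : Type*}

theorem mem_combLang_iff (M : ABA A X) (w : ℕ → D) (s : BCp X) :
    w ∈ M.combLang s ↔ s.Holds (w ∈ M.stateLang ·) := by
  induction s <;> simp_all [combLang, BCp.Holds]

theorem mem_split (M : ABA A X) {a : Finset (Finset X)} {p : Finset X × Finset X} :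
    p ∈ M.split a ↔ ∃ Z ∈ a, (Z.filter (· ∉ M.F), Z.filter (· ∈ M.F)) = p :=
  Finset.mem_image

theorem mem_altProd (M : ABA A X) {a b : Finset (Finset X)} {p : Finset X × Finset X} :
    p ∈ M.altProd a b ↔
      ∃ Z ∈ a, ∃ Y ∈ b, (Z.filter (· ∉ M.F), Y ∪ Z.filter (· ∈ M.F)) = p :=
  Finset.mem_image₂

theorem biUnion_mem_leafOf_tfINFSet (M : ABA A X) (a : D) (U : Finset X) (g : X → Finset X)
    (hg : ∀ q ∈ U, g q ∈ ((M.tf q).leafOf A a).dnf) :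
    U.biUnion g ∈ (M.tfINFSet U).leafOf A a := by
  have h : ∀ l : List X, (∀ q ∈ l, g q ∈ ((M.tf q).leafOf A a).dnf) →
      l.toFinset.biUnion g ∈ (l.foldr (fun q f => TT.map₂ BCp.dnfAnd (M.tfINF q) f)
        (TT.leaf {∅} : TT Ψ (Finset (Finset X)))).leafOf A a := by
    intro l hl
    induction l with
    | nil => simp [TT.leafOf]
    | cons q l ih =>
      rw [List.foldr_cons, TT.leafOf_map₂, tfINF, TT.leafOf_map, List.toFinset_cons,
        Finset.biUnion_insert]
      exact Finset.mem_image₂_of_mem (hl q (by simp)) (ih fun p hp => hl p (by simp [hp]))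
  simpa [tfINFSet] using h U.toList (by simpa using hg)

/-- A member of the conjoined normal form is a union of one choice for each state. Inclusion is all
that is kept of this, since later uses only need every chosen successor to occur in the pair. -/
theorem exists_subset_of_mem_leafOf_tfINFSet (M : ABA A X) (a : D) (U Z : Finset X)
    (hZ : Z ∈ (M.tfINFSet U).leafOf A a) :
    ∀ q ∈ U, ∃ Y ∈ ((M.tf q).leafOf A a).dnf, Y ⊆ Z := by
  have h : ∀ l : List X, ∀ Z ∈ (l.foldr (fun q f => TT.map₂ BCp.dnfAnd (M.tfINF q) f)
        (TT.leaf {∅} : TT Ψ (Finset (Finset X)))).leafOf A a,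
      ∀ q ∈ l, ∃ Y ∈ ((M.tf q).leafOf A a).dnf, Y ⊆ Z := by
    intro l
    induction l with
    | nil => simp
    | cons q l ih =>
      intro Z hZ p hp
      rw [List.foldr_cons, TT.leafOf_map₂, tfINF, TT.leafOf_map] at hZ
      obtain ⟨x, hx, y, hy, rfl⟩ := Finset.mem_image₂.1 hZ
      rcases List.mem_cons.1 hp with rfl | hp
      · exact ⟨x, hx, Finset.subset_union_left⟩
      · obtain ⟨Y, hY, h⟩ := ih y hy p hp
        exact ⟨Y, hY, h.trans Finset.subset_union_right⟩
  exact fun q hq => h U.toList Z hZ q (Finset.mem_toList.2 hq)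

theorem isNondeterministic_elim (M : ABA A X) : M.elim.IsNondeterministic := by
  refine ⟨BCp.noAnd_disj _, fun q _ s hs => ?_⟩
  simp only [elim, TT.leaves_map] at hs
  obtain ⟨B, -, rfl⟩ := hs
  exact BCp.noAnd_disj _

theorem mem_dnf_leafOf_tf_elim (M : ABA A X) (s : Finset X × Finset X) (a : D)
    (Z : Finset (Finset X × Finset X)) :
    Z ∈ ((M.elim.tf s).leafOf A a).dnf ↔ ∃ p ∈ (M.elimTerm s).leafOf A a, {p} = Z := by
  simp only [elim, TT.leafOf_map, BCp.mem_dnf_disj]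

/-- The first components of the states of `M.elim` avoid `F`. -/
theorem ElimState.notMem_F {M : ABA A X} {s : Finset X × Finset X} (h : M.ElimState s) :
    ∀ q ∈ s.1, q ∉ M.F := by
  have hsplit : ∀ a, ∀ p ∈ M.split a, ∀ q ∈ p.1, q ∉ M.F := by
    intro a p hp q hq
    obtain ⟨Z, -, rfl⟩ := (mem_split M).1 hp
    exact (Finset.mem_filter.1 hq).2
  cases h with
  | init _ hp => exact hsplit _ _ hp
  | step s _ B _ hB hp =>
    unfold elimTerm at hB
    split_ifs at hB
    · rw [TT.leaves_map] at hB
      obtain ⟨a, -, rfl⟩ := hB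
      exact hsplit a _ hp
    · rw [TT.leaves_map₂] at hB
      obtain ⟨a, -, b, -, rfl⟩ := hB
      obtain ⟨Z, -, Y, -, rfl⟩ := (mem_altProd M).1 hp
      exact fun q hq => (Finset.mem_filter.1 hq).2

/-- The successor of a pair if all its elements move according to `Z`. -/
noncomputable def elimSucc (M : ABA A X) (Z : X → Finset X) (s : Finset X × Finset X) :
    Finset X × Finset X :=
  if s.1 = ∅ then ((s.2.biUnion Z).filter (· ∉ M.F), (s.2.biUnion Z).filter (· ∈ M.F))
  else ((s.1.biUnion Z).filter (· ∉ M.F), s.2.biUnion Z ∪ (s.1.biUnion Z).filter (· ∈ M.F))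

theorem elimSucc_mem (M : ABA A X) (a : D) (Z : X → Finset X) (s : Finset X × Finset X)
    (h : ∀ q ∈ s.1 ∪ s.2, Z q ∈ ((M.tf q).leafOf A a).dnf) :
    M.elimSucc Z s ∈ (M.elimTerm s).leafOf A a := by
  have h1 := M.biUnion_mem_leafOf_tfINFSet a s.1 Z fun q hq => h q (Finset.mem_union_left _ hq)
  have h2 := M.biUnion_mem_leafOf_tfINFSet a s.2 Z fun q hq => h q (Finset.mem_union_right _ hq)
  unfold elimSucc elimTerm
  split_ifs
  · rw [TT.leafOf_map]
    exact M.mem_split.2 ⟨_, h2, rfl⟩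
  · rw [TT.leafOf_map₂]
    exact M.mem_altProd.2 ⟨_, h1, _, h2, rfl⟩

theorem elimSucc_subset (M : ABA A X) (Z : X → Finset X) (s : Finset X × Finset X) :
    ∀ p ∈ (M.elimSucc Z s).1 ∪ (M.elimSucc Z s).2, ∃ q ∈ s.1 ∪ s.2, p ∈ Z q := by
  intro p hp
  unfold elimSucc at hp
  split_ifs at hp
  all_goals
    simp only [Finset.mem_union, Finset.mem_filter, Finset.mem_biUnion] at hp ⊢
    grind

/-- A positional strategy for `M` yields one for `M.elim`, whose rank is the largest rank in
the first component. -/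
theorem IsStrategy.elim {O : Type*} [LinearOrder O] [OrderBot O] {M : ABA A X} {w : ℕ → D}
    {W : ℕ → X → Prop} {Z : ℕ → X → Finset X} {r : ℕ → X → O} (h : M.IsStrategy w W Z r) :
    M.elim.IsStrategy w (fun n s => M.ElimState s ∧ ∀ q ∈ s.1 ∪ s.2, W n q)
      (fun n s => {M.elimSucc (Z n) s}) (fun n s => s.1.sup (r n)) := by
  rintro n s ⟨hs, hW⟩
  have hmem := M.elimSucc_mem (w n) (Z n) s fun q hq => (h n q (hW q hq)).1
  have hstate : M.ElimState (M.elimSucc (Z n) s) :=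
    .step s _ _ hs (TT.leafOf_mem_leaves A _ _) hmem
  refine ⟨?_, fun p hp => ?_⟩
  · exact (mem_dnf_leafOf_tf_elim M s _ _).2 ⟨_, hmem, rfl⟩
  · rw [Finset.mem_singleton] at hp
    subst hp
    refine ⟨⟨hstate, fun p hp => ?_⟩, fun hF hF' => ?_⟩
    · obtain ⟨q, hq, hpq⟩ := M.elimSucc_subset (Z n) s p hp
      exact ((h n q (hW q hq)).2 p hpq).1
    · have h0 : s.1 ≠ ∅ := fun h0 => hF ⟨hs, h0⟩
      have h1 : (M.elimSucc (Z n) s).1 ≠ ∅ := fun h1 => hF' ⟨hstate, h1⟩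
      -- The new first component is nonempty, so its supremum is attained at some `p`. As the old
      -- one is nonempty too, `p` descends from an element of it, and neither is in `F`.
      obtain ⟨p, hp, hsup⟩ :=
        Finset.exists_mem_eq_sup _ (Finset.nonempty_iff_ne_empty.2 h1) (r (n + 1))
      change (M.elimSucc (Z n) s).1.sup (r (n + 1)) < s.1.sup (r n)
      rw [hsup]
      have hp' := hp
      rw [elimSucc, if_neg h0, Finset.mem_filter, Finset.mem_biUnion] at hp'
      obtain ⟨⟨q, hq, hpq⟩, hpF⟩ := hp'
      exact (((h n q (hW q (Finset.mem_union_left _ hq))).2 p hpq).2 (hs.notMem_F q hq)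
        hpF).trans_le (Finset.le_sup hq)

/-- The states along a branch of an accepting run of `M.elim`. -/
theorem exists_seq_of_mem_stateLang_elim (M : ABA A X) {w : ℕ → D} {s : Finset X × Finset X}
    (h : w ∈ M.elim.stateLang s) : ∃ σ : ℕ → Finset X × Finset X, σ 0 = s ∧
      (∀ n, σ (n + 1) ∈ (M.elimTerm (σ n)).leafOf A (w n)) ∧
      ∃ᶠ n in Filter.atTop, (σ n).1 = ∅ := by
  obtain ⟨t, ⟨h0, hrun⟩, hacc⟩ := h
  have hstep : ∀ x : t.nodes, ∃ k, x.1 ++ [k] ∈ t.nodes ∧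
      t.label (x.1 ++ [k]) ∈ (M.elimTerm (t.label x.1)).leafOf A (w x.1.length) := by
    rintro ⟨x, hx⟩
    obtain ⟨Z, hZ, hc⟩ := hrun x hx
    obtain ⟨p, hp, rfl⟩ := (mem_dnf_leafOf_tf_elim M _ _ _).1 hZ
    obtain ⟨k, hk, hl⟩ : p ∈ {p | ∃ k, x ++ [k] ∈ t.nodes ∧ t.label (x ++ [k]) = p} := by
      rw [hc]; simp
    exact ⟨k, hk, hl ▸ hp⟩
  choose k hk hl using hstep
  -- Every node has a child, so iterating the choice of one gives an infinite branch.
  let x : ℕ → t.nodes := fun n =>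
    n.rec ⟨[], t.root_mem⟩ fun _ y => ⟨y.1 ++ [k y], hk y⟩
  have hx : ∀ n, (List.range n).map (fun i => k (x i)) = (x n).1 := by
    intro n
    induction n with
    | zero => rfl
    | succ n ih => rw [List.range_succ, List.map_append, ih]; rfl
  refine ⟨fun n => t.label (x n).1, h0, fun n => ?_, ?_⟩
  · have : (x n).1.length = n := by rw [← hx]; simp
    simpa [this] using hl (x n)
  · refine (hacc (fun i => k (x i)) fun n => by rw [hx]; exact (x n).2).mono fun n hn => ?_
    rw [hx] at hn
    exact hn.2

/-- The moves of the elements of a pair along a transition of `M.elim`.  The flag tells whether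
the element belongs to the first component. -/
theorem exists_move_of_mem_elimTerm (M : ABA A X) {a : D} {s s' : Finset X × Finset X}
    (h : s' ∈ (M.elimTerm s).leafOf A a) (m : Bool) (q : X)
    (hq : q ∈ if m then s.1 else s.2) :
    ∃ Z ∈ ((M.tf q).leafOf A a).dnf, ∀ p ∈ Z, ∃ m' : Bool,
      (p ∈ if m' then s'.1 else s'.2) ∧ (m' = true ↔ p ∉ M.F ∧ (m = true ∨ s.1 = ∅)) := by
  unfold elimTerm at h
  split_ifs at h with h0
  · rw [TT.leafOf_map, mem_split] at h
    obtain ⟨Z, hZ, rfl⟩ := h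
    -- The first component is empty, so the flag of `q` must be `false`.
    have hq : q ∈ s.2 := by cases m <;> simp_all
    obtain ⟨Y, hY, hYZ⟩ := M.exists_subset_of_mem_leafOf_tfINFSet a _ _ hZ q hq
    refine ⟨Y, hY, fun p hp => ⟨decide (p ∉ M.F), ?_, by simp [h0]⟩⟩
    by_cases hF : p ∈ M.F <;> simp [hF, hYZ hp]
  · rw [TT.leafOf_map₂, mem_altProd] at h
    obtain ⟨Z, hZ, Y, hY, rfl⟩ := h
    cases m with
    | false =>
      obtain ⟨Y', hY', hs⟩ := M.exists_subset_of_mem_leafOf_tfINFSet a _ _ hY q (by simpa using hq)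
      exact ⟨Y', hY', fun p hp => ⟨false, by simp [hs hp], by simp [h0]⟩⟩
    | true =>
      obtain ⟨Z', hZ', hs⟩ := M.exists_subset_of_mem_leafOf_tfINFSet a _ _ hZ q (by simpa using hq)
      refine ⟨Z', hZ', fun p hp => ⟨decide (p ∉ M.F), ?_, by simp⟩⟩
      by_cases hF : p ∈ M.F <;> simp [hF, hs hp]

/-- A graph of labelled nodes at depths: the labels of the successors of a node satisfy the
transition term of its label, and every infinite path visits `F`. -/
structure IsRunGraph {S : Type*} (M : ABA A X) (w : ℕ → D) (succ : S → S → Prop)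
    (label : S → X) (depth : S → ℕ) : Prop where
  depth_succ : ∀ s s', succ s s' → depth s' = depth s + 1
  holds : ∀ s, ((M.tf (label s)).leafOf A (w (depth s))).Holds
    fun p => ∃ s', succ s s' ∧ label s' = p
  visits : ∀ f : ℕ → S, (∀ n, succ (f n) (f (n + 1))) → ∃ n, label (f n) ∈ M.F

/-- The nodes of an accepting run form a run graph. -/
theorem IsRun.isRunGraph {M : ABA A X} {w : ℕ → D} {q : X} {t : LabelledTree X}
    (h : M.IsRun w q t) (hacc : M.IsAccepting t) :
    M.IsRunGraph w (fun x y : t.nodes => ∃ k, y.1 = x.1 ++ [k]) (fun x => t.label x.1)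
      (fun x => x.1.length) where
  depth_succ := by
    rintro x y ⟨k, hk⟩
    simp [hk]
  holds := by
    rintro ⟨x, hx⟩
    obtain ⟨Z, hZ, hc⟩ := h.2 x hx
    refine (BCp.holds_iff_exists_mem_dnf _ _).2 ⟨Z, hZ, fun p hp => ?_⟩
    obtain ⟨k, hk, hl⟩ : p ∈ {p | ∃ k, x ++ [k] ∈ t.nodes ∧ t.label (x ++ [k]) = p} := by
      rw [hc]; exact hp
    exact ⟨⟨_, hk⟩, ⟨k, rfl⟩, hl⟩
  visits := by
    intro f hf
    choose k hk using hf
    have hfn : ∀ n, (f 0).1 ++ (List.range n).map k = (f n).1 := by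
      intro n
      induction n with
      | zero => simp
      | succ n ih => rw [List.range_succ, List.map_append, ← List.append_assoc, ih, hk]; rfl
    obtain ⟨n, hn⟩ := (hacc.frequently (f 0).1 k fun n => by rw [hfn]; exact (f n).2).exists
    exact ⟨n, by rwa [hfn] at hn⟩

/-- The elements of the states along an accepting branch of a run of `M.elim` form a run graph
of `M`. -/
theorem isRunGraph_of_seq (M : ABA A X) {w : ℕ → D} {σ : ℕ → Finset X × Finset X}
    (hσ : ∀ n, σ (n + 1) ∈ (M.elimTerm (σ n)).leafOf A (w n))
    (hF : ∃ᶠ n in Filter.atTop, (σ n).1 = ∅) :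
    M.IsRunGraph w
      (fun s s' : {s : ℕ × Bool × X // s.2.2 ∈ if s.2.1 then (σ s.1).1 else (σ s.1).2} =>
        s'.1.1 = s.1.1 + 1 ∧
          (s'.1.2.1 = true ↔ s'.1.2.2 ∉ M.F ∧ (s.1.2.1 = true ∨ (σ s.1.1).1 = ∅)))
      (fun s => s.1.2.2) (fun s => s.1.1) where
  depth_succ := fun s s' h => h.1
  holds := by
    rintro ⟨⟨n, m, q⟩, hq⟩
    obtain ⟨Z, hZ, h⟩ := M.exists_move_of_mem_elimTerm (hσ n) m q hq
    refine (BCp.holds_iff_exists_mem_dnf _ _).2 ⟨Z, hZ, fun p hp => ?_⟩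
    obtain ⟨m', hm', h'⟩ := h p hp
    exact ⟨⟨(n + 1, m', p), hm'⟩, ⟨rfl, h'⟩, rfl⟩
  visits := by
    intro f hf
    by_contra! hnF
    rw [Filter.frequently_atTop] at hF
    have hd : ∀ n, (f n).1.1 = (f 0).1.1 + n := by
      intro n
      induction n with
      | zero => rfl
      | succ n ih => rw [(hf n).1, ih, add_assoc]
    obtain ⟨n₀, h0, hn0⟩ := hF (f 0).1.1
    obtain ⟨a, rfl⟩ := Nat.exists_eq_add_of_le h0
    -- Once the first component has been empty, a path avoiding `F` enters the first component and
    -- cannot leave it.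
    have hm : ∀ b, (f (a + 1 + b)).1.2.1 = true := by
      intro b
      induction b with
      | zero => exact (hf a).2.2 ⟨hnF _, .inr (by rw [hd]; exact hn0)⟩
      | succ b ih => exact (hf (a + 1 + b)).2.2 ⟨hnF _, .inl ih⟩
    -- When the first component is empty once more, the path would have an element in it.
    obtain ⟨n₁, h1, hn1⟩ := hF ((f 0).1.1 + (a + 1))
    obtain ⟨b, rfl⟩ := Nat.exists_eq_add_of_le h1
    have := (f (a + 1 + b)).2
    rw [hm, hd, if_pos rfl, ← add_assoc, hn1] at this
    simp at this

end ABA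

/-! ### Semantics of formulas: expansion laws, negation normal form, derivatives -/

namespace LTL

variable {D : Type*} {Ψ : Type*}

theorem rest_rest (m n : ℕ) (w : ℕ → D) : rest m (rest n w) = rest (n + m) w := by
  funext i
  simp [rest, add_assoc]

theorem rest_zero (w : ℕ → D) : rest 0 w = w := by
  funext i
  simp [rest]

theorem models_untl_iff (A : ElementAlgebra D Ψ) (w : ℕ → D) (φ ψ : LTL Ψ) :
    Models A w (untl φ ψ) ↔ Models A w ψ ∨ (Models A w φ ∧ Models A (rest 1 w) (untl φ ψ)) := by
  simp only [Models, rest_rest]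
  constructor
  · rintro ⟨_ | j, hj, h⟩
    · exact .inl (by simpa [rest_zero] using hj)
    · refine .inr ⟨by simpa [rest_zero] using h 0 (by omega), j, ?_, fun i hi => ?_⟩
      · rwa [add_comm]
      · simpa [add_comm] using h (i + 1) (by omega)
  · rintro (h | ⟨h, j, hj, h'⟩)
    · exact ⟨0, by rwa [rest_zero], by simp⟩
    · refine ⟨1 + j, hj, fun i hi => ?_⟩
      rcases i with _ | i
      · rwa [rest_zero]
      · simpa [add_comm] using h' i (by omega)

theorem models_release_iff (A : ElementAlgebra D Ψ) (w : ℕ → D) (φ ψ : LTL Ψ) :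
    Models A w (release φ ψ) ↔
      Models A w ψ ∧ (Models A w φ ∨ Models A (rest 1 w) (release φ ψ)) := by
  simp only [Models, rest_rest]
  constructor
  · rintro (h | ⟨_ | j, hj, h⟩)
    · exact ⟨by simpa [rest_zero] using h 0, .inr (.inl fun j => h _)⟩
    · exact ⟨by simpa [rest_zero] using h 0 le_rfl, .inl (by simpa [rest_zero] using hj)⟩
    · refine ⟨by simpa [rest_zero] using h 0 (by omega), .inr (.inr ⟨j, ?_, fun i hi => ?_⟩)⟩
      · rwa [add_comm]
      · exact h _ (by omega)
  · rintro ⟨h, h' | h' | ⟨j, hj, h'⟩⟩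
    · refine .inr ⟨0, by rwa [rest_zero], fun i hi => ?_⟩
      rw [Nat.le_zero.1 hi]
      rwa [rest_zero]
    · refine .inl fun j => ?_
      rcases j with _ | j
      · rwa [rest_zero]
      · simpa [add_comm] using h' j
    · refine .inr ⟨1 + j, hj, fun i hi => ?_⟩
      rcases i with _ | i
      · rwa [rest_zero]
      · simpa [add_comm] using h' i (by omega)

theorem models_nnf (A : ElementAlgebra D Ψ) (φ : LTL Ψ) : ∀ (b : Bool) (w : ℕ → D),
    Models A w (nnf A b φ) ↔ if b then Models A w φ else ¬ Models A w φ := by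
  induction φ with
  | pred α => intro b w; cases b <;> simp [nnf, Models, A.den_not]
  | not φ ih => intro b w; cases b <;> simp [nnf, Models, ih]
  | or φ ψ ih1 ih2 => intro b w; cases b <;> simp [nnf, Models, ih1, ih2]
  | and φ ψ ih1 ih2 => intro b w; cases b <;> simp [nnf, Models, ih1, ih2]; tauto
  | next φ ih => intro b w; cases b <;> simp [nnf, Models, ih]
  | untl φ ψ ih1 ih2 =>
    intro b w
    cases b
    · simp only [nnf, Models, ih1, ih2, Bool.false_eq_true, if_false]
      constructor
      · rintro (h | ⟨j, hj, h⟩) ⟨k, hk, h'⟩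
        · exact h k hk
        · by_cases hjk : j < k
          · exact hj (h' j hjk)
          · exact h k (by omega) hk
      · intro h
        by_cases hψ : ∃ k, Models A (rest k w) ψ
        · right
          by_contra! hn
          -- At the first position where `ψ` holds, a failure of `φ` before it would have to be
          -- preceded by, or coincide with, a still earlier `ψ`.
          refine h ⟨Nat.find hψ, Nat.find_spec hψ, fun i hi => ?_⟩
          by_contra hφ
          obtain ⟨k, hk, hk'⟩ := hn i hφ
          exact Nat.find_min hψ (hk.trans_lt hi) hk'
        · exact .inl fun j hj => hψ ⟨j, hj⟩
    · simp [nnf, Models, ih1, ih2]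
  | release φ ψ ih1 ih2 =>
    intro b w
    cases b
    · simp only [nnf, Models, ih1, ih2, Bool.false_eq_true, if_false]
      constructor
      · rintro ⟨j, hj, h⟩ (h' | ⟨k, hk, h'⟩)
        · exact hj (h' j)
        · by_cases hjk : k < j
          · exact h k hjk hk
          · exact hj (h' j (by omega))
      · intro h
        rw [not_or, not_forall] at h
        refine ⟨Nat.find h.1, Nat.find_spec h.1, fun i hi hφ => h.2 ⟨i, hφ, fun k hk => ?_⟩⟩
        exact not_not.1 (Nat.find_min h.1 (hk.trans_lt hi))
    · simp [nnf, Models, ih1, ih2]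

theorem models_pred_top (A : ElementAlgebra D Ψ) (w : ℕ → D) : Models A w (pred A.top) := by
  simp [Models, A.den_top]

theorem not_models_pred_bot (A : ElementAlgebra D Ψ) (w : ℕ → D) :
    ¬ Models A w (pred A.bot) := by
  simp [Models, A.den_bot]

theorem holds_toBCp (A : ElementAlgebra D Ψ) (w : ℕ → D) (φ : LTL Ψ) :
    (toBCp A φ).Holds (Models A w) ↔ Models A w φ := by
  induction φ with
  | pred α =>
    unfold toBCp
    split_ifs with h h'
    · simpa [BCp.Holds, h] using models_pred_top A w
    · simpa [BCp.Holds, h'] using not_models_pred_bot A w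
    · rfl
  | or φ ψ ih1 ih2 => simp [toBCp, BCp.holds_mkOr, ih1, ih2, Models]
  | and φ ψ ih1 ih2 => simp [toBCp, BCp.holds_mkAnd, ih1, ih2, Models]
  | _ => rfl

/-- Correctness of symbolic derivatives. -/
theorem models_leafOf_deriv (A : ElementAlgebra D Ψ) (w : ℕ → D) (φ : LTL Ψ) :
    Models A (rest 1 w) ((deriv A φ).leafOf A (w 0)) ↔ Models A w φ := by
  induction φ with
  | pred α =>
    unfold deriv
    split_ifs with h h'
    · simp [TT.leafOf, models_pred_top, h]
    · simp [TT.leafOf, not_models_pred_bot, h']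
    · by_cases hw : w 0 ∈ A.den α <;>
        simp [TT.leafOf, hw, models_pred_top, not_models_pred_bot]
      · exact hw
      · exact hw
  | not φ ih => simp [deriv, TT.leafOf_map, Models, ih]
  | or φ ψ ih1 ih2 => simp [deriv, TT.leafOf_map₂, Models, ih1, ih2]
  | and φ ψ ih1 ih2 => simp [deriv, TT.leafOf_map₂, Models, ih1, ih2]
  | next φ ih => rfl
  | untl φ ψ ih1 ih2 =>
    rw [models_untl_iff, ← ih1, ← ih2]
    simp only [deriv, TT.leafOf_map₂, TT.leafOf]
    rfl
  | release φ ψ ih1 ih2 =>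
    rw [models_release_iff, ← ih1, ← ih2]
    simp only [deriv, TT.leafOf_map₂, TT.leafOf]
    rfl

theorem holds_leafOf_deriv (A : ElementAlgebra D Ψ) (w : ℕ → D) (φ : LTL Ψ) (n : ℕ) :
    (toBCp A ((deriv A φ).leafOf A (w n))).Holds (fun p => Models A (rest (n + 1) w) p) ↔
      Models A (rest n w) φ := by
  rw [holds_toBCp, ← models_leafOf_deriv A (rest n w), rest_rest]
  rfl

theorem atoms_leafOf_deriv (A : ElementAlgebra D Ψ) {φ : LTL Ψ} (hφ : φ.Positive) (a : D) :
    (toBCp A ((deriv A φ).leafOf A a)).atoms ⊆ subs φ :=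
  atoms_deriv A φ hφ _ (TT.leafOf_mem_leaves A _ _)

/-- The leaves are the formulas `⊤` and `⊥`, which `toBCp` turns into constants; a predicate never
needs a successor. -/
theorem atoms_leafOf_deriv_pred (A : ElementAlgebra D Ψ) (α : Ψ) (a : D) :
    (toBCp A ((deriv A (pred α)).leafOf A a)).atoms = ∅ := by
  refine Set.eq_empty_iff_forall_notMem.2 fun p hp => ?_
  unfold deriv at hp
  split_ifs at hp with h1 h2
  · simp [TT.leafOf, toBCp, BCp.atoms] at hp
  · simp only [TT.leafOf, toBCp] at hp
    split_ifs at hp <;> simp [BCp.atoms] at hp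
  · simp only [TT.leafOf] at hp
    split_ifs at hp <;> simp only [toBCp] at hp <;> split_ifs at hp <;> simp [BCp.atoms] at hp

theorem sizeOf_le_of_mem_subs (φ : LTL Ψ) : ∀ q ∈ subs φ, sizeOf q ≤ sizeOf φ := by
  induction φ with
  | pred α => rintro q rfl; exact le_rfl
  | not φ ih => intro q h; have := ih q h; simp; omega
  | next φ ih =>
    rintro q (rfl | h)
    · exact le_rfl
    · have := ih q h; simp; omega
  | or φ ψ ih1 ih2 =>
    rintro q (h | h)
    · have := ih1 q h; simp; omega
    · have := ih2 q h; simp; omega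
  | and φ ψ ih1 ih2 =>
    rintro q (h | h)
    · have := ih1 q h; simp; omega
    · have := ih2 q h; simp; omega
  | untl φ ψ ih1 ih2 =>
    rintro q (rfl | h | h)
    · exact le_rfl
    · have := ih1 q h; simp; omega
    · have := ih2 q h; simp; omega
  | release φ ψ ih1 ih2 =>
    rintro q (rfl | h | h)
    · exact le_rfl
    · have := ih1 q h; simp; omega
    · have := ih2 q h; simp; omega

theorem positive_of_mem_states (A : ElementAlgebra D Ψ) {φ : LTL Ψ} (hφ : φ.Positive)
    {q : LTL Ψ} (hq : q ∈ states A φ) : q.Positive := by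
  rcases hq with (rfl | rfl) | hq
  · trivial
  · trivial
  · exact positive_of_mem_subs φ hφ q hq

theorem leafOf_tf_toABA (A : ElementAlgebra D Ψ) (φ : LTL Ψ) (hφ : φ.Positive) (q : LTL Ψ)
    (a : D) : ((toABA A φ hφ).tf q).leafOf A a = toBCp A ((deriv A q).leafOf A a) :=
  TT.leafOf_map A _ _ _

/-! ### Soundness -/

/-- The labels of the nodes of a run graph hold at the positions given by the depths. -/
theorem models_of_isRunGraph (A : ElementAlgebra D Ψ) {φ : LTL Ψ} {hφ : φ.Positive}
    {S : Type*} {w : ℕ → D} {succ : S → S → Prop} {label : S → LTL Ψ} {depth : S → ℕ}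
    (h : (toABA A φ hφ).IsRunGraph w succ label depth) (s : S) (hs : (label s).Positive) :
    Models A (rest (depth s) w) (label s) := by
  have hholds := h.holds
  simp only [leafOf_tf_toABA] at hholds
  induction hk : sizeOf (label s) using Nat.strong_induction_on generalizing s with
  | _ k ih =>
  subst hk
  -- The induction hypothesis, transported back through the derivative. The size is compared with
  -- `label s` but the node is arbitrary, so that it applies all along a path that repeats this
  -- label.
  have sub : ∀ (s₁ : S) (χ : LTL Ψ), χ.Positive → sizeOf χ < sizeOf (label s) →
      (toBCp A ((deriv A χ).leafOf A (w (depth s₁)))).Holds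
        (fun p => ∃ s', succ s₁ s' ∧ label s' = p) → Models A (rest (depth s₁) w) χ := by
    intro s₁ χ hχ hlt hχ'
    refine (holds_leafOf_deriv A w χ _).1 (hχ'.mono ?_)
    rintro p hp ⟨s', hs', rfl⟩
    have hp := atoms_leafOf_deriv A hχ _ hp
    rw [← h.depth_succ _ _ hs']
    exact ih _ ((sizeOf_le_of_mem_subs χ _ hp).trans_lt hlt) s' (positive_of_mem_subs χ hχ _ hp) rfl
  have path : ∀ T : S → Prop, T s → (∀ s₁, T s₁ → ∃ s₂, succ s₁ s₂ ∧ T s₂) →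
      ∃ f : ℕ → S, (∀ n, succ (f n) (f (n + 1))) ∧ ∀ n, T (f n) ∧ depth (f n) = depth s + n := by
    intro T hT hstep
    have hstep' : ∀ x : {x // T x}, ∃ y : {x // T x}, succ x.1 y.1 := fun x =>
      let ⟨y, hy, hy'⟩ := hstep x.1 x.2
      ⟨⟨y, hy'⟩, hy⟩
    choose g hg using hstep'
    have hsucc : ∀ n, succ (g^[n] ⟨s, hT⟩).1 (g^[n + 1] ⟨s, hT⟩).1 := fun n => by
      rw [Function.iterate_succ_apply']
      exact hg _
    refine ⟨fun n => (g^[n] ⟨s, hT⟩).1, hsucc, fun n => ⟨(g^[n] ⟨s, hT⟩).2, ?_⟩⟩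
    induction n with
    | zero => rfl
    | succ n ihn => rw [h.depth_succ _ _ (hsucc n), ihn, add_assoc]
  have hs0 := hholds s
  cases hl : label s with
  | not φ => rw [hl] at hs; exact hs.elim
  | pred α =>
    rw [hl] at hs0
    refine (holds_leafOf_deriv A w _ _).1 (hs0.mono ?_)
    simp [atoms_leafOf_deriv_pred]
  | or φ ψ =>
    rw [hl] at hs hs0 sub
    simp only [deriv, TT.leafOf_map₂, toBCp, BCp.holds_mkOr] at hs0
    exact hs0.imp (sub s φ hs.1 (by simp; omega)) (sub s ψ hs.2 (by simp))
  | and φ ψ =>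
    rw [hl] at hs hs0 sub
    simp only [deriv, TT.leafOf_map₂, toBCp, BCp.holds_mkAnd] at hs0
    exact hs0.imp (sub s φ hs.1 (by simp; omega)) (sub s ψ hs.2 (by simp))
  | next φ =>
    rw [hl] at hs hs0 ih
    -- The derivative is `φ` itself rather than the derivative of a smaller formula, so `sub` does
    -- not apply; the atoms of `φ` are smaller than the label.
    refine (holds_leafOf_deriv A w _ _).1 (hs0.mono ?_)
    rintro p hp ⟨s', hs', rfl⟩
    have hp := atoms_toBCp A φ hs hp
    rw [← h.depth_succ _ _ hs']
    refine ih _ ((sizeOf_le_of_mem_subs φ _ hp).trans_lt (by simp)) s'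
      (positive_of_mem_subs φ hs _ hp) rfl
  | untl φ ψ =>
    by_contra hn
    -- Where the `U`-formula is false, the induction excludes fulfilment now; the other disjunct
    -- gives a successor with the same label, at which it is false again.
    obtain ⟨f, hf, hT⟩ := path
      (fun s₁ => label s₁ = untl φ ψ ∧ ¬ Models A (rest (depth s₁) w) (untl φ ψ)) ⟨hl, hn⟩ (by
        rintro s₁ ⟨hl₁, hn₁⟩
        rw [hl] at hs sub
        have h1 := hholds s₁
        rw [models_untl_iff, rest_rest, not_or, not_and] at hn₁
        simp only [hl₁, deriv, TT.leafOf_map₂, toBCp, BCp.holds_mkOr, BCp.holds_mkAnd] at h1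
        rcases h1 with h1 | ⟨h1, s₂, h2, h3⟩
        · exact (hn₁.1 (sub s₁ ψ hs.2 (by simp) h1)).elim
        · refine ⟨s₂, h2, h3, ?_⟩
          rw [h.depth_succ _ _ h2]
          exact hn₁.2 (sub s₁ φ hs.1 (by simp; omega) h1))
    obtain ⟨n, -, hF⟩ := h.visits f hf
    simp [(hT n).1.1, IsRelease] at hF
  | release φ ψ =>
    by_contra hn
    have hstep : ∀ s₁, label s₁ = release φ ψ → Models A (rest (depth s₁) w) ψ ∧
        (Models A (rest (depth s₁) w) φ ∨ ∃ s₂, succ s₁ s₂ ∧ label s₂ = release φ ψ) := by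
      intro s₁ hl₁
      rw [hl] at hs sub
      have h1 := hholds s₁
      simp only [hl₁, deriv, TT.leafOf_map₂, toBCp, BCp.holds_mkOr, BCp.holds_mkAnd] at h1
      exact h1.imp (sub s₁ ψ hs.2 (by simp)) (Or.imp_left (sub s₁ φ hs.1 (by simp; omega)))
    obtain ⟨f, -, hT⟩ := path
      (fun s₁ => label s₁ = release φ ψ ∧ ¬ Models A (rest (depth s₁) w) (release φ ψ))
      ⟨hl, hn⟩ (by
        rintro s₁ ⟨hl₁, hn₁⟩
        obtain ⟨h1, h2⟩ := hstep s₁ hl₁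
        rw [models_release_iff, rest_rest, not_and, not_or] at hn₁
        obtain ⟨s₂, h3, h4⟩ := h2.resolve_left (hn₁ h1).1
        refine ⟨s₂, h3, h4, ?_⟩
        rw [h.depth_succ _ _ h3]
        exact (hn₁ h1).2)
    -- Staying at an `R`-formula forever is no contradiction to acceptance, but it makes `ψ` true at
    -- every position.
    refine hn (.inl fun j => ?_)
    rw [rest_rest, ← (hT j).2]
    exact (hstep _ (hT j).1.1).1

theorem models_of_mem_stateLang (A : ElementAlgebra D Ψ) {φ : LTL Ψ} {hφ : φ.Positive}
    {w : ℕ → D} {q : LTL Ψ} (hq : q.Positive) (h : w ∈ (toABA A φ hφ).stateLang q) :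
    Models A w q := by
  obtain ⟨t, ht, hacc⟩ := h
  have := models_of_isRunGraph A (ht.isRunGraph hacc) ⟨[], t.root_mem⟩ (by simpa [ht.1] using hq)
  simpa [ht.1, rest_zero] using this

theorem models_of_mem_stateLang_elim (A : ElementAlgebra D Ψ) {φ : LTL Ψ} {hφ : φ.Positive}
    {w : ℕ → D} {s : Finset (LTL Ψ) × Finset (LTL Ψ)}
    (h : w ∈ (toABA A φ hφ).elim.stateLang s) {q : LTL Ψ} (hqs : q ∈ s.1 ∪ s.2)
    (hq : q.Positive) : Models A w q := by
  obtain ⟨σ, rfl, hσ, hF⟩ := ABA.exists_seq_of_mem_stateLang_elim _ h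
  have hg := ABA.isRunGraph_of_seq _ hσ hF
  rcases Finset.mem_union.1 hqs with h1 | h2
  · simpa [rest_zero] using models_of_isRunGraph A hg ⟨(0, true, q), by simpa using h1⟩ hq
  · simpa [rest_zero] using models_of_isRunGraph A hg ⟨(0, false, q), by simpa using h2⟩ hq

/-! ### Completeness -/

/-- The number of steps until a `U`-formula is fulfilled. -/
noncomputable def untlDist (A : ElementAlgebra D Ψ) (w : ℕ → D) : LTL Ψ → ℕ
  | untl _ ψ => sInf {j | Models A (rest j w) ψ}
  | _ => 0

/-- The rank of a formula at a position: its size, then the distance to its fulfilment. -/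
noncomputable def rank (A : ElementAlgebra D Ψ) (w : ℕ → D) (n : ℕ) (q : LTL Ψ) : ℕ ×ₗ ℕ :=
  toLex (sizeOf q, untlDist A (rest n w) q)

theorem rank_lt_of_mem_subs (A : ElementAlgebra D Ψ) (w : ℕ → D) (n m : ℕ) {p χ q : LTL Ψ}
    (hp : p ∈ subs χ) (h : sizeOf χ < sizeOf q) : rank A w m p < rank A w n q :=
  Prod.Lex.toLex_lt_toLex.2 (.inl ((sizeOf_le_of_mem_subs χ p hp).trans_lt h))

/-- The sizes agree, and the first position of `ψ`, which is not the current one, comes one step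
closer. -/
theorem rank_untl_lt (A : ElementAlgebra D Ψ) (w : ℕ → D) (n : ℕ) {φ ψ : LTL Ψ}
    (h : Models A (rest (n + 1) w) (untl φ ψ)) (hn : ¬ Models A (rest n w) ψ) :
    rank A w (n + 1) (untl φ ψ) < rank A w n (untl φ ψ) := by
  refine Prod.Lex.toLex_lt_toLex.2 (.inr ⟨rfl, ?_⟩)
  obtain ⟨j, hj, -⟩ := h
  simp only [untlDist, rest_rest] at hj ⊢
  -- Nonemptiness matters: the infimum of an empty set would be the default value 0.
  have hne : {j | Models A (rest (n + j) w) ψ}.Nonempty := ⟨1 + j, by simpa [add_assoc] using hj⟩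
  have hmem := Nat.sInf_mem hne
  generalize sInf {j | Models A (rest (n + j) w) ψ} = i at hmem
  rcases i with _ | i
  · exact (hn hmem).elim
  · refine Nat.lt_succ_of_le (Nat.sInf_le ?_)
    simpa [add_assoc, add_comm 1 i] using hmem

/-- All successors are smaller subformulas, except when a `U`- or `R`-formula repeats itself. A
`U`-formula is fulfilled as soon as possible and postponed only while `ψ` is false, so its distance
decreases; `R`-formulas are exempt. -/
theorem holds_rank_lt (A : ElementAlgebra D Ψ) (w : ℕ → D) (n : ℕ) {q : LTL Ψ}
    (hq : q.Positive) (h : Models A (rest n w) q) :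
    (toBCp A ((deriv A q).leafOf A (w n))).Holds fun p =>
      Models A (rest (n + 1) w) p ∧ (¬ q.IsRelease → rank A w (n + 1) p < rank A w n q) := by
  have hq0 := (holds_leafOf_deriv A w q n).2 h
  have sub : ∀ χ : LTL Ψ, χ.Positive → sizeOf χ < sizeOf q → Models A (rest n w) χ →
      (toBCp A ((deriv A χ).leafOf A (w n))).Holds fun p =>
        Models A (rest (n + 1) w) p ∧ (¬ q.IsRelease → rank A w (n + 1) p < rank A w n q) :=
    fun χ hχ hlt hm => ((holds_leafOf_deriv A w χ n).2 hm).mono fun p hp hpm =>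
      ⟨hpm, fun _ => rank_lt_of_mem_subs A w _ _ (atoms_leafOf_deriv A hχ _ hp) hlt⟩
  cases q with
  | not φ => exact hq.elim
  | pred α =>
    refine hq0.mono ?_
    simp [atoms_leafOf_deriv_pred]
  | or φ ψ =>
    simp only [deriv, TT.leafOf_map₂, toBCp, BCp.holds_mkOr]
    exact h.imp (sub φ hq.1 (by simp; omega)) (sub ψ hq.2 (by simp))
  | and φ ψ =>
    simp only [deriv, TT.leafOf_map₂, toBCp, BCp.holds_mkAnd]
    exact h.imp (sub φ hq.1 (by simp; omega)) (sub ψ hq.2 (by simp))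
  | next φ =>
    exact hq0.mono fun p hp hpm =>
      ⟨hpm, fun _ => rank_lt_of_mem_subs A w _ _ (atoms_toBCp A φ hq hp) (by simp)⟩
  | untl φ ψ =>
    simp only [deriv, TT.leafOf_map₂, toBCp, BCp.holds_mkOr, BCp.holds_mkAnd]
    by_cases hψ : Models A (rest n w) ψ
    · exact .inl (sub ψ hq.2 (by simp) hψ)
    · rw [models_untl_iff, rest_rest] at h
      obtain ⟨h1, h2⟩ := h.resolve_left hψ
      exact .inr ⟨sub φ hq.1 (by simp; omega) h1, h2, fun _ => rank_untl_lt A w n h2 hψ⟩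
  | release φ ψ => exact hq0.mono fun p _ hpm => ⟨hpm, fun hr => (hr trivial).elim⟩

/-- The configurations at which the formula holds have a positional strategy. -/
theorem exists_isStrategy (A : ElementAlgebra D Ψ) (φ : LTL Ψ) (hφ : φ.Positive) (w : ℕ → D) :
    ∃ Z, (toABA A φ hφ).IsStrategy w
      (fun n q => q ∈ states A φ ∧ Models A (rest n w) q) Z (rank A w) := by
  have h : ∀ n q, ∃ Z : Finset (LTL Ψ), (q ∈ states A φ ∧ Models A (rest n w) q) →
      Z ∈ (((toABA A φ hφ).tf q).leafOf A (w n)).dnf ∧ ∀ p ∈ Z,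
        (p ∈ states A φ ∧ Models A (rest (n + 1) w) p) ∧
          (q ∉ (toABA A φ hφ).F → p ∉ (toABA A φ hφ).F →
            rank A w (n + 1) p < rank A w n q) := by
    intro n q
    by_cases hq : q ∈ states A φ ∧ Models A (rest n w) q
    · have := holds_rank_lt A w n (positive_of_mem_states A hφ hq.1) hq.2
      rw [← leafOf_tf_toABA A φ hφ, BCp.holds_iff_exists_mem_dnf] at this
      obtain ⟨Z, hZ, h⟩ := this
      refine ⟨Z, fun _ => ⟨hZ, fun p hp => ⟨⟨?_, (h p hp).1⟩, fun hF _ => (h p hp).2 fun hr =>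
        hF ⟨hq.1, .inl hr⟩⟩⟩⟩
      exact (toABA A φ hφ).tf_mem q hq.1 _ (TT.leafOf_mem_leaves A _ _)
        (BCp.subset_atoms_of_mem_dnf _ Z hZ hp)
    -- An arbitrary value where the strategy is not constrained.
    · exact ⟨∅, fun h => (hq h).elim⟩
  choose Z hZ using h
  exact ⟨Z, hZ⟩

/-! ### Languages -/

theorem stateLang_toABA (A : ElementAlgebra D Ψ) (φ : LTL Ψ) (hφ : φ.Positive) {q : LTL Ψ}
    (hq : q ∈ (toABA A φ hφ).Q) : (toABA A φ hφ).stateLang q = q.lang A := by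
  ext w
  refine ⟨models_of_mem_stateLang A (positive_of_mem_states A hφ hq), fun h => ?_⟩
  obtain ⟨Z, hZ⟩ := exists_isStrategy A φ hφ w
  exact hZ.mem_stateLang ⟨hq, by rwa [rest_zero]⟩

theorem models_conj (A : ElementAlgebra D Ψ) (w : ℕ → D) (U : Finset (LTL Ψ)) :
    Models A w (conj A U) ↔ ∀ q ∈ U, Models A w q := by
  have h : ∀ l : List (LTL Ψ), Models A w (l.foldr and (pred A.top)) ↔ ∀ q ∈ l, Models A w q := by
    intro l
    induction l with
    | nil => simpa using models_pred_top A w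
    | cons q l ih => simp [Models, ih]
  simpa [conj] using h U.toList

theorem stateLang_elim_toABA (A : ElementAlgebra D Ψ) (φ : LTL Ψ) (hφ : φ.Positive)
    {s : Finset (LTL Ψ) × Finset (LTL Ψ)} (hs : s ∈ (toABA A φ hφ).elim.Q) :
    (toABA A φ hφ).elim.stateLang s = (pairConj A s).lang A := by
  have hsub : ∀ q ∈ s.1 ∪ s.2, q ∈ states A φ := fun q hq =>
    (Finset.mem_union.1 hq).elim (fun h => (ABA.ElimState.subset hs).1 h)
      (fun h => (ABA.ElimState.subset hs).2 h)
  ext w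
  refine Iff.trans ?_ (models_conj A w _).symm
  refine ⟨fun h q hq =>
    models_of_mem_stateLang_elim A h hq (positive_of_mem_states A hφ (hsub q hq)), fun h => ?_⟩
  obtain ⟨Z, hZ⟩ := exists_isStrategy A φ hφ w
  exact hZ.elim.mem_stateLang ⟨hs, fun q hq => ⟨hsub q hq, by rw [rest_zero]; exact h q hq⟩⟩

theorem lang_elim_toABA (A : ElementAlgebra D Ψ) (φ : LTL Ψ) (hφ : φ.Positive) :
    (toABA A φ hφ).elim.lang = φ.lang A := by
  ext w
  have h : w ∈ (toABA A φ hφ).elim.lang ↔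
      ∃ s ∈ (toABA A φ hφ).split (toBCp A φ).dnf, w ∈ (toABA A φ hφ).elim.stateLang s := by
    rw [ABA.lang, ABA.mem_combLang_iff, BCp.holds_iff_exists_mem_dnf]
    change (∃ Z ∈ (BCp.disj ((toABA A φ hφ).split (toBCp A φ).dnf)).dnf, _) ↔ _
    simp [BCp.mem_dnf_disj]
  rw [h]
  refine Iff.trans ?_ (holds_toBCp A w φ)
  rw [BCp.holds_iff_exists_mem_dnf]
  -- The two halves of an initial pair have union `Z`, so its language is that of the conjunction of
  -- `Z`.
  have hl : ∀ Z ∈ (toBCp A φ).dnf,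
      (w ∈ (toABA A φ hφ).elim.stateLang
        (Z.filter (· ∉ (toABA A φ hφ).F), Z.filter (· ∈ (toABA A φ hφ).F)) ↔
          ∀ p ∈ Z, Models A w p) := by
    intro Z hZ
    rw [stateLang_elim_toABA A φ hφ (.init _ ((ABA.mem_split _).2 ⟨Z, hZ, rfl⟩))]
    refine (models_conj A w _).trans (forall_congr' fun p => ?_)
    by_cases hp : p ∈ (toABA A φ hφ).F <;> simp [hp]
  constructor
  · rintro ⟨s, hs, hw⟩
    obtain ⟨Z, hZ, rfl⟩ := (ABA.mem_split _).1 hs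
    exact ⟨Z, hZ, (hl Z hZ).1 hw⟩
  · rintro ⟨Z, hZ, hw⟩
    exact ⟨_, (ABA.mem_split _).2 ⟨Z, hZ, rfl⟩, (hl Z hZ).2 hw⟩

end LTL

end LTLModulo

theorem mainTheorem4 {D : Type*} {Ψ : Type*} (A : LTLModulo.ElementAlgebra D Ψ) :
    (∀ (φ : LTLModulo.LTL Ψ) (hφ : φ.Positive),
      (∀ ψ ∈ (φ.toABA A hφ).Q, (φ.toABA A hφ).stateLang ψ = ψ.lang A) ∧
      (∀ q ∈ (φ.toABA A hφ).elim.Q,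
        (φ.toABA A hφ).elim.stateLang q = (LTLModulo.LTL.pairConj A q).lang A) ∧
      (φ.toABA A hφ).elim.IsNondeterministic ∧
      (φ.toABA A hφ).elim.lang = φ.lang A) ∧
    (∀ φ : LTLModulo.LTL Ψ,
      (φ.toNBA A).IsNondeterministic ∧ (φ.toNBA A).lang = φ.lang A) := by
  refine ⟨fun φ hφ => ⟨fun ψ => LTLModulo.LTL.stateLang_toABA A φ hφ,
    fun q => LTLModulo.LTL.stateLang_elim_toABA A φ hφ,
    LTLModulo.ABA.isNondeterministic_elim _, LTLModulo.LTL.lang_elim_toABA A φ hφ⟩,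
    fun φ => ⟨LTLModulo.ABA.isNondeterministic_elim _, ?_⟩⟩
  refine (LTLModulo.LTL.lang_elim_toABA A _ (LTLModulo.LTL.nnf_positive A φ true)).trans ?_
  ext w
  exact LTLModulo.LTL.models_nnf A φ true w
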